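/- Let $F$ be a free group of arbitrary rank with free basis $\{z_j \mid j\in J\}$, and let $H = F/[F,F]$, written additively. Let $F_1 = F$, $F_{k+1} = [F_k,F]$ be the lower central series and let $I^k$ be the powers of the augmentation ideal $I$ of the group ring $\mathbb{Z}F$. Consider the homomorphisms $$F_k/F_{k+1} \xrightarrow{\psi_k} I^k/I^{k+1} \xrightarrow{i_k} H^{\otimes k} \xrightarrow{j_k} (H\otimes\mathbb{R})^{\otimes k},$$ where $\psi_k([g]) = [g-1]$, $i_k$ is the linear map with $i_k([(z_{j_1}-1)\cdots(z_{j_k}-1)]) = [z_{j_1}]\otimes\cdots\otimes[z_{j_k}]$ (these products represent a $\mathbb{Z}$-basis of $I^k/I^{k+1}$), and $j_k(a_1\otimes\cdots\otimes a_k) = (a_1\otimes 1)\otimes\cdots\otimes(a_k\otimes 1)$. An ordered basis $\mathcal{B}$ of a real vector space $M$ is a basis $(v_s)_{s\in S}$ together with a strict total order $\prec$ on $S$. The lexicographic ordering $<_{\mathcal{B}}$ of $M$ is given by $\alpha <_{\mathcal{B}} \beta$ iff $\beta-\alpha\neq 0$ and the coefficient of $\beta-\alpha$ at the $\prec$-least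 index with nonzero coefficient is positive. The ordered basis $\mathcal{B}^{\otimes k}$ of $M^{\otimes k}$ consists of the tensors $v_{s_1}\otimes\cdots\otimes v_{s_k}$, ordered lexicographically in $(s_1,\dots,s_k)$. A linear map $f : M\to M$ is positively triangular with respect to $\mathcal{B}$ if there is a map $\eta : S\to S$ with $s\prec t \Rightarrow \eta(s)\prec\eta(t)$ such that for every $s\in S$ $$f(v_s) = \lambda_s v_{\eta(s)} + \sum_{t\succ\eta(s)} c_{s,t}v_t,\qquad \lambda_s>0,\ c_{s,t}\in\mathbb{R};$$ $f$ is positively triangular if it is so with respect to some ordered basis. Let $\mathcal{B}$ be an ordered basis of $H\otimes\mathbb{R}$. Order $F_k/F_{k+1}$ by $a<_k b$ iff $j_k i_k\psi_k(a) <_{\mathcal{B}^{\otimes k}} j_k i_k\psi_k(b)$. For $a\in F$, $a\ne 1$, let $k(a)$ be the largest $k$ with $a\in F_k$; call $a$ positive iff $[a]>_{k(a)}1$ in $F_{k(a)}/F_{k(a)+1}$, and set $a<_{\mathcal{B}}b$ iff $a^{-1}b$ is positive. Then: 1. $<_{\mathcal{B}}$ is a bi-ordering of $F$ (a strict total ordering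 invariant under left and right multiplication), and it does not depend on the choice of the free basis $\{z_j\}$. 2. If $\varphi$ is an automorphism of $F$ with induced automorphism $\varphi_{ab}$ of $H$ such that $\varphi_{ab}\otimes \mathrm{Id} : H\otimes\mathbb{R}\to H\otimes\mathbb{R}$ is positively triangular with respect to $\mathcal{B}$, then $<_{\mathcal{B}}$ is invariant under $\varphi$, that is, $f<_{\mathcal{B}}g \iff \varphi(f)<_{\mathcal{B}}\varphi(g)$ for all $f,g\in F$. Consequently, if $\varphi$ is an automorphism of $F$ such that $\varphi_{ab}\otimes\mathrm{Id}$ is positively triangular (with respect to some ordered basis), then there is a bi-ordering of $F$ that is invariant under $\varphi$. -/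

import Mathlib

open scoped TensorProduct

noncomputable section

namespace FreeGroupOrder

universe u v w

/-! ### Bi-orderings of groups -/

/-- A bi-ordering of a group: a strict total ordering invariant under left and right
multiplication. -/
structure IsBiOrdering {G : Type u} [Group G] (lt : G → G → Prop) : Prop where
  strictTotal : IsStrictTotalOrder G lt
  mul_left : ∀ f g h : G, lt f g → lt (h * f) (h * g)
  mul_right : ∀ f g h : G, lt f g → lt (f * h) (g * h)

/-- The ordering `lt` of `G` is invariant under the automorphism `φ`. -/
def IsInvariant {G : Type u} [Group G] (lt : G → G → Prop) (φ : G ≃* G) : Prop :=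
  ∀ f g : G, lt f g ↔ lt (φ f) (φ g)

/-! ### Ordered bases

An ordered basis of a real vector space `M` is a basis `B : Module.Basis I ℝ M` whose index type
`I` carries a linear order. -/

section OrderedBases

variable {M : Type u} [AddCommGroup M] [Module ℝ M] {I : Type w} [LinearOrder I]

/-- `α` is positive in the lexicographic ordering associated with `B`: the coefficient of `α` at
the least index where it does not vanish exists and is positive. -/
def LexPos (B : Module.Basis I ℝ M) (α : M) : Prop :=
  ∃ i : I, IsLeast {j : I | B.repr α j ≠ 0} i ∧ 0 < B.repr α i

/-- The lexicographic ordering of `M` associated with the ordered basis `B`. -/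
def LexLT (B : Module.Basis I ℝ M) (α β : M) : Prop := LexPos B (β - α)

/-- `f` is positively triangular with respect to the ordered basis `B`: there is an
order-preserving `η : I → I` such that `f (B i)` is a positive multiple of `B (η i)` plus a
(finite) linear combination of the `B j` with `j` strictly above `η i`. -/
def IsPositivelyTriangularWrt (B : Module.Basis I ℝ M) (f : M →ₗ[ℝ] M) : Prop :=
  ∃ η : I → I, StrictMono η ∧ ∀ i : I, ∃ (c₀ : ℝ) (c : I →₀ ℝ), 0 < c₀ ∧
    (∀ j ∈ c.support, η i < j) ∧ f (B i) = c₀ • B (η i) + c.sum fun j r => r • B j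

/-- `f` is positively triangular with respect to some ordered basis. -/
def IsPositivelyTriangular (f : M →ₗ[ℝ] M) : Prop :=
  ∃ (I : Type u) (_ : LinearOrder I) (B : Module.Basis I ℝ M), IsPositivelyTriangularWrt B f

/-- The ordered basis `B ⊗ ⋯ ⊗ B` (`k` factors) of the tensor power: it consists of all
`B (s 0) ⊗ ⋯ ⊗ B (s (k - 1))`, and the index tuples `s` are ordered lexicographically. -/
def tensorPowerBasis (B : Module.Basis I ℝ M) (k : ℕ) :
    Module.Basis (Lex (Fin k → I)) ℝ (⨂[ℝ]^k M) :=
  (Basis.piTensorProduct fun _ : Fin k => B).reindex toLex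

end OrderedBases

/-! ### The abelianisation and its tensor powers -/

section Abelianisation

variable (F : Type u) [Group F]

/-- The abelianisation `H = F / [F, F]`, written additively. -/
abbrev H : Type u := Additive (Abelianization F)

/-- The real vector space `H ⊗ ℝ`. -/
abbrev HR : Type u := ℝ ⊗[ℤ] H F

variable {F}

/-- The class in `H` of an element of `F`. -/
def toH (g : F) : H F := Additive.ofMul (Abelianization.of g)

/-- The endomorphism of `H` induced by an automorphism of `F`. -/
def phiAb (φ : F ≃* F) : H F →ₗ[ℤ] H F :=
  (MonoidHom.toAdditive (Abelianization.map φ.toMonoidHom)).toIntLinearMap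

/-- The endomorphism `φ_ab ⊗ Id` of `H ⊗ ℝ`. -/
def phiAbR (φ : F ≃* F) : HR F →ₗ[ℝ] HR F := (phiAb φ).baseChange ℝ

variable (F)

/-- The map `H^{⊗ k} → (H ⊗ ℝ)^{⊗ k}`, `a₁ ⊗ ⋯ ⊗ aₖ ↦ (a₁ ⊗ 1) ⊗ ⋯ ⊗ (aₖ ⊗ 1)`. -/
def jMap (k : ℕ) : ⨂[ℤ]^k (H F) →ₗ[ℤ] ⨂[ℝ]^k (HR F) :=
  PiTensorProduct.lift
    (((PiTensorProduct.tprod ℝ (s := fun _ : Fin k => HR F)).restrictScalars ℤ).compLinearMap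
      fun _ => TensorProduct.mk ℤ ℝ (H F) 1)

theorem jMap_tprod (k : ℕ) (a : Fin k → H F) :
    jMap F k (PiTensorProduct.tprod ℤ a) =
      PiTensorProduct.tprod ℝ fun s => (1 : ℝ) ⊗ₜ[ℤ] a s := by
  simp only [jMap, PiTensorProduct.lift.tprod]
  rfl

end Abelianisation

/-! ### Powers of the augmentation ideal of the integral group ring -/

section Augmentation

variable (F : Type u) [Group F]

/-- The augmentation `ℤF → ℤ`, sending every element of `F` to `1`. -/
def aug : MonoidAlgebra ℤ F →ₐ[ℤ] ℤ := MonoidAlgebra.lift ℤ ℤ F 1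

/-- The augmentation ideal of `ℤF`. -/
def augIdeal : Ideal (MonoidAlgebra ℤ F) := RingHom.ker (aug F)

instance : (augIdeal F).IsTwoSided := by unfold augIdeal; infer_instance

/-- The quotient `I^k / I^{k+1}` of powers of the augmentation ideal `I`. -/
abbrev AugGr (k : ℕ) : Type u :=
  ↥(augIdeal F ^ k) ⧸ (augIdeal F ^ (k + 1)).submoduleOf (augIdeal F ^ k)

variable {F}

/-- The class in `I^k / I^{k+1}` of an element of `I^k`. -/
def augMk (k : ℕ) (x : MonoidAlgebra ℤ F) (hx : x ∈ augIdeal F ^ k) : AugGr F k :=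
  Submodule.Quotient.mk ⟨x, hx⟩

theorem augMk_eq_iff {k : ℕ} {x y : MonoidAlgebra ℤ F} (hx : x ∈ augIdeal F ^ k)
    (hy : y ∈ augIdeal F ^ k) :
    augMk k x hx = augMk k y hy ↔ x - y ∈ augIdeal F ^ (k + 1) := by
  unfold augMk
  rw [Submodule.Quotient.eq]
  rfl

/-- The element `g - 1` of the group ring. -/
def del (g : F) : MonoidAlgebra ℤ F := MonoidAlgebra.of ℤ F g - 1

theorem aug_of (g : F) : aug F (MonoidAlgebra.of ℤ F g) = 1 := by simp [aug]

theorem mem_augIdeal {x : MonoidAlgebra ℤ F} : x ∈ augIdeal F ↔ aug F x = 0 := Iff.rfl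

theorem del_mem (g : F) : del g ∈ augIdeal F := by
  rw [mem_augIdeal, del, map_sub, aug_of, map_one, sub_self]

/-- The product `(z_{j₁} - 1) ⋯ (z_{jₖ} - 1)`. -/
def monomial {J : Type v} (z : J → F) {k : ℕ} (j : Fin k → J) : MonoidAlgebra ℤ F :=
  (List.ofFn fun s => del (z (j s))).prod

theorem monomial_succ {J : Type v} (z : J → F) {k : ℕ} (j : Fin (k + 1) → J) :
    monomial z j = monomial z (fun s => j s.castSucc) * del (z (j (Fin.last k))) := by
  unfold monomial
  rw [List.ofFn_succ', List.concat_eq_append, List.prod_append, List.prod_singleton]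

theorem monomial_mem {J : Type v} (z : J → F) {k : ℕ} (j : Fin k → J) :
    monomial z j ∈ augIdeal F ^ k := by
  induction k with
  | zero => rw [Submodule.pow_zero, Ideal.one_eq_top]; trivial
  | succ k ih =>
    rw [monomial_succ, Submodule.pow_succ]
    exact Ideal.mul_mem_mul (ih _) (del_mem _)

end Augmentation

/-! ### Fox derivatives and the standard basis of `I^k / I^{k+1}` -/

section Fox

variable {F : Type u} [Group F] {J : Type v}

open Classical in
/-- The affine action of `F` on `ℤF` in which the free generator `z_j` acts by
`x ↦ z_j x + δ_{ij}`. -/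
def foxAction (z : FreeGroupBasis J F) (i : J) : F →* Equiv.Perm (MonoidAlgebra ℤ F) :=
  z.lift fun j =>
    { toFun := fun x => MonoidAlgebra.of ℤ F (z j) * x + if i = j then 1 else 0
      invFun := fun x => MonoidAlgebra.of ℤ F (z j)⁻¹ * (x - if i = j then 1 else 0)
      left_inv := fun x => by
        beta_reduce
        rw [add_sub_cancel_right, ← mul_assoc, ← map_mul, inv_mul_cancel, map_one, one_mul]
      right_inv := fun x => by
        beta_reduce
        rw [← mul_assoc, ← map_mul, mul_inv_cancel, map_one, one_mul, sub_add_cancel] }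

open Classical in
theorem foxAction_basis (z : FreeGroupBasis J F) (i j : J) (x : MonoidAlgebra ℤ F) :
    foxAction z i (z j) x = MonoidAlgebra.of ℤ F (z j) * x + if i = j then 1 else 0 := by
  have h : ∀ f : J → Equiv.Perm (MonoidAlgebra ℤ F), z.lift f (z j) = f j := fun f => by simp
  unfold foxAction
  rw [h]
  rfl

theorem closure_range_basis (z : FreeGroupBasis J F) :
    Subgroup.closure (Set.range z) = ⊤ := by
  have h : (MonoidHom.id F) = (Subgroup.closure (Set.range z)).subtype.comp
      (z.lift fun j => ⟨z j, Subgroup.subset_closure ⟨j, rfl⟩⟩) := by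
    apply z.ext_hom
    intro j
    simp
  rw [eq_top_iff]
  intro g _
  have := DFunLike.congr_fun h g
  simp only [MonoidHom.id_apply, MonoidHom.comp_apply] at this
  rw [this]
  exact Subtype.property _

theorem foxAction_apply (z : FreeGroupBasis J F) (i : J) (g : F) (x : MonoidAlgebra ℤ F) :
    foxAction z i g x = MonoidAlgebra.of ℤ F g * x + foxAction z i g 0 := by
  classical
  have hg : g ∈ Subgroup.closure (Set.range z) := by rw [closure_range_basis]; trivial
  induction hg using Subgroup.closure_induction generalizing x with
  | mem g hg =>
    obtain ⟨j, rfl⟩ := hg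
    rw [foxAction_basis, foxAction_basis, mul_zero, zero_add]
  | one => rw [map_one, map_one, Equiv.Perm.one_apply, Equiv.Perm.one_apply, one_mul, add_zero]
  | mul g h _ _ ihg ihh =>
    rw [map_mul, Equiv.Perm.mul_apply, Equiv.Perm.mul_apply, ihg, ihh, ihg (foxAction z i h 0),
      map_mul]
    noncomm_ring
  | inv g _ ih =>
    apply (foxAction z i g).injective
    rw [← Equiv.Perm.mul_apply, ← map_mul, mul_inv_cancel, map_one, Equiv.Perm.one_apply, ih,
      mul_add, ← mul_assoc, ← map_mul, mul_inv_cancel, map_one, one_mul, add_assoc, ← ih,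
      ← Equiv.Perm.mul_apply, ← map_mul, mul_inv_cancel, map_one, Equiv.Perm.one_apply, add_zero]

/-- The Fox derivative `∂/∂z_i`, extended linearly to the group ring. -/
def fox (z : FreeGroupBasis J F) (i : J) : MonoidAlgebra ℤ F →ₗ[ℤ] MonoidAlgebra ℤ F :=
  (Finsupp.linearCombination ℤ fun g => foxAction z i g 0) ∘ₗ
    (MonoidAlgebra.coeffLinearEquiv ℤ).toLinearMap

theorem fox_of (z : FreeGroupBasis J F) (i : J) (g : F) :
    fox z i (MonoidAlgebra.of ℤ F g) = foxAction z i g 0 := by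
  simp [fox, MonoidAlgebra.of_apply]

/-- The product rule for Fox derivatives. -/
theorem fox_mul (z : FreeGroupBasis J F) (i : J) (x y : MonoidAlgebra ℤ F) :
    fox z i (x * y) = aug F y • fox z i x + x * fox z i y := by
  induction y using MonoidAlgebra.induction_on with
  | of h =>
    rw [aug_of, one_smul]
    induction x using MonoidAlgebra.induction_on with
    | of g =>
      rw [← map_mul, fox_of, fox_of, fox_of, map_mul, Equiv.Perm.mul_apply, foxAction_apply,
        add_comm]
    | add x y hx hy => rw [add_mul, map_add, hx, hy, map_add, add_mul]; abel
    | smul r x hx => rw [smul_mul_assoc, map_smul, hx, map_smul, smul_add, smul_mul_assoc]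
  | add a b ha hb => rw [mul_add, map_add, ha, hb, map_add, map_add, add_smul, mul_add]; abel
  | smul r a ha =>
    rw [mul_smul_comm, map_smul, ha, map_smul, map_smul, smul_add, mul_smul_comm, smul_assoc]

open Classical in
theorem fox_mul_del (z : FreeGroupBasis J F) (i j : J) (x : MonoidAlgebra ℤ F) :
    fox z i (x * del (z j)) = if i = j then x else 0 := by
  have h1 : fox z i 1 = 0 := by
    rw [← map_one (MonoidAlgebra.of ℤ F), fox_of, map_one, Equiv.Perm.one_apply]
  rw [fox_mul, mem_augIdeal.1 (del_mem (z j)), zero_smul, zero_add, del, map_sub, h1, sub_zero,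
    fox_of, foxAction_basis, mul_zero, zero_add]
  split_ifs <;> simp

theorem fox_mem (z : FreeGroupBasis J F) (i : J) (k : ℕ) {x : MonoidAlgebra ℤ F}
    (hx : x ∈ augIdeal F ^ (k + 1)) : fox z i x ∈ augIdeal F ^ k := by
  rw [Submodule.pow_succ] at hx
  refine Submodule.smul_induction_on hx (fun a ha b hb => ?_) fun a b ha hb => ?_
  · rw [smul_eq_mul, fox_mul, mem_augIdeal.1 hb, zero_smul, zero_add]
    exact Ideal.mul_mem_right _ _ ha
  · rw [map_add]
    exact add_mem ha hb

/-- The coefficient of the monomial with index tuple `j`, as an iterated Fox derivative. -/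
def foxCoeff (z : FreeGroupBasis J F) : (k : ℕ) → (Fin k → J) → (MonoidAlgebra ℤ F →ₗ[ℤ] ℤ)
  | 0, _ => (aug F).toLinearMap
  | k + 1, j => foxCoeff z k (fun s => j s.castSucc) ∘ₗ fox z (j (Fin.last k))

theorem foxCoeff_eq_zero (z : FreeGroupBasis J F) {k : ℕ} (j : Fin k → J)
    {x : MonoidAlgebra ℤ F} (hx : x ∈ augIdeal F ^ (k + 1)) : foxCoeff z k j x = 0 := by
  induction k generalizing x with
  | zero => rw [zero_add, Submodule.pow_one] at hx; exact hx
  | succ k ih => exact ih _ (fox_mem z _ _ hx)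

open Classical in
theorem foxCoeff_monomial (z : FreeGroupBasis J F) {k : ℕ} (j l : Fin k → J) :
    foxCoeff z k j (monomial z l) = if j = l then 1 else 0 := by
  induction k with
  | zero => simp [foxCoeff, monomial, Subsingleton.elim j l]
  | succ k ih =>
    rw [monomial_succ]
    simp only [foxCoeff, LinearMap.comp_apply, fox_mul_del]
    by_cases h : j (Fin.last k) = l (Fin.last k)
    · rw [if_pos h, ih]
      congr 1
      rw [eq_iff_iff]
      constructor
      · intro h'
        funext s
        induction s using Fin.lastCases with
        | last => exact h
        | cast s => exact congrFun h' s
      · rintro rfl; rfl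
    · rw [if_neg h, map_zero, if_neg]
      rintro rfl
      exact h rfl

theorem linearIndependent_monomial (z : FreeGroupBasis J F) (k : ℕ) :
    LinearIndependent ℤ fun j : Fin k → J => augMk k (monomial z j) (monomial_mem z j) := by
  classical
  rw [linearIndependent_iff']
  intro s c hc j hj
  have h : ∑ l ∈ s, c l • monomial z l ∈ augIdeal F ^ (k + 1) := by
    have hsum : (⟨∑ l ∈ s, c l • monomial z l, Submodule.sum_mem _ fun l _ =>
        zsmul_mem (monomial_mem z l) _⟩ : ↥(augIdeal F ^ k)) =
        ∑ l ∈ s, c l • ⟨monomial z l, monomial_mem z l⟩ := by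
      ext1
      simp
    have : Submodule.Quotient.mk (p := (augIdeal F ^ (k + 1)).submoduleOf (augIdeal F ^ k))
        (∑ l ∈ s, c l • (⟨monomial z l, monomial_mem z l⟩ : ↥(augIdeal F ^ k))) = 0 := by
      rw [← hc, ← Submodule.mkQ_apply, map_sum]
      refine Finset.sum_congr rfl fun l _ => ?_
      rw [map_zsmul]
      rfl
    rw [← hsum, Submodule.Quotient.mk_eq_zero] at this
    exact this
  have h2 := foxCoeff_eq_zero z j h
  rw [map_sum] at h2
  simp only [map_smul, foxCoeff_monomial] at h2
  simpa [hj] using h2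

/-- The augmentation ideal is generated by the `z_j - 1`. -/
theorem augIdeal_eq_span (z : FreeGroupBasis J F) :
    augIdeal F = Ideal.span (Set.range fun j => del (z j)) := by
  apply le_antisymm
  · have hdel : ∀ g : F, del g ∈ Ideal.span (Set.range fun j => del (z j)) := by
      intro g
      have hg : g ∈ Subgroup.closure (Set.range z) := by rw [closure_range_basis]; trivial
      induction hg using Subgroup.closure_induction with
      | mem g hg =>
        obtain ⟨j, rfl⟩ := hg
        exact Ideal.subset_span ⟨j, rfl⟩
      | one => rw [del, map_one, sub_self]; exact zero_mem _
      | mul g h _ _ hg hh =>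
        have : del (g * h) = MonoidAlgebra.of ℤ F g * del h + del g := by
          simp only [del, map_mul]; noncomm_ring
        rw [this]
        exact add_mem (Ideal.mul_mem_left _ _ hh) hg
      | inv g _ hg =>
        have : del g⁻¹ = -(MonoidAlgebra.of ℤ F g⁻¹ * del g) := by
          rw [del, del, mul_sub, ← map_mul, inv_mul_cancel, map_one, mul_one]; abel
        rw [this]
        exact neg_mem (Ideal.mul_mem_left _ _ hg)
    have hall : ∀ x : MonoidAlgebra ℤ F, x - algebraMap ℤ _ (aug F x) ∈
        Ideal.span (Set.range fun j => del (z j)) := by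
      intro x
      induction x using MonoidAlgebra.induction_on with
      | of g => rw [aug_of, map_one]; exact hdel g
      | add x y hx hy =>
        rw [map_add, map_add, add_sub_add_comm]
        exact add_mem hx hy
      | smul r x hx =>
        rw [map_smul, smul_eq_mul, map_mul, ← Algebra.smul_def, ← smul_sub]
        exact zsmul_mem hx r
    intro x hx
    have := hall x
    rwa [mem_augIdeal.1 hx, map_zero, sub_zero] at this
  · rw [Ideal.span_le]
    rintro _ ⟨j, rfl⟩
    exact del_mem _

/-- Modulo `I ^ (k + 1)`, every element of `I ^ k` is an integral combination of monomials. -/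
theorem exists_span_monomial (z : FreeGroupBasis J F) (k : ℕ) {x : MonoidAlgebra ℤ F}
    (hx : x ∈ augIdeal F ^ k) :
    ∃ m ∈ Submodule.span ℤ (Set.range fun j : Fin k → J => monomial z j),
      x - m ∈ augIdeal F ^ (k + 1) := by
  induction k generalizing x with
  | zero =>
    refine ⟨aug F x • 1, Submodule.smul_mem _ _ (Submodule.subset_span ⟨Fin.elim0, rfl⟩), ?_⟩
    rw [zero_add, Submodule.pow_one, mem_augIdeal, map_sub, map_smul, map_one, smul_eq_mul,
      mul_one, sub_self]
  | succ k ih =>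
    rw [Submodule.pow_succ] at hx
    refine Submodule.smul_induction_on hx (fun a ha b hb => ?_) ?_
    · rw [smul_eq_mul]
      rw [augIdeal_eq_span z] at hb
      induction hb using Submodule.span_induction generalizing a with
      | mem b hb =>
        obtain ⟨j, rfl⟩ := hb
        obtain ⟨m, hm, hr⟩ := ih ha
        refine ⟨m * del (z j), ?_, ?_⟩
        · clear hr
          induction hm using Submodule.span_induction with
          | mem m hm =>
            obtain ⟨l, rfl⟩ := hm
            refine Submodule.subset_span ⟨Fin.snoc l j, ?_⟩
            beta_reduce
            rw [monomial_succ]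
            simp
          | zero => rw [zero_mul]; exact zero_mem _
          | add m n _ _ hm hn => rw [add_mul]; exact add_mem hm hn
          | smul r m _ hm => rw [smul_mul_assoc]; exact Submodule.smul_mem _ r hm
        · rw [← sub_mul, Submodule.pow_succ]
          exact Ideal.mul_mem_mul hr (del_mem _)
      | zero => exact ⟨0, zero_mem _, by rw [mul_zero, sub_zero]; exact zero_mem _⟩
      | add b c _ _ hb hc =>
        obtain ⟨m, hm, hr⟩ := hb a ha
        obtain ⟨n, hn, hs⟩ := hc a ha
        refine ⟨m + n, add_mem hm hn, ?_⟩
        rw [mul_add, add_sub_add_comm]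
        exact add_mem hr hs
      | smul r b _ hb =>
        rw [smul_eq_mul, ← mul_assoc]
        exact hb (a * r) (Ideal.mul_mem_right _ _ ha)
    · rintro a b ⟨m, hm, hr⟩ ⟨n, hn, hs⟩
      refine ⟨m + n, add_mem hm hn, ?_⟩
      rw [add_sub_add_comm]
      exact add_mem hr hs

theorem span_monomial (z : FreeGroupBasis J F) (k : ℕ) :
    ⊤ ≤ Submodule.span ℤ
      (Set.range fun j : Fin k → J => augMk k (monomial z j) (monomial_mem z j)) := by
  intro q _
  obtain ⟨⟨x, hx⟩, rfl⟩ := Submodule.Quotient.mk_surjective _ q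
  obtain ⟨m, hm, hr⟩ := exists_span_monomial z k hx
  have key : ∃ hm' : m ∈ augIdeal F ^ k, augMk k m hm' ∈ Submodule.span ℤ
      (Set.range fun j : Fin k → J => augMk k (monomial z j) (monomial_mem z j)) := by
    clear hr
    induction hm using Submodule.span_induction with
    | mem m hm =>
      obtain ⟨l, rfl⟩ := hm
      exact ⟨monomial_mem z l, Submodule.subset_span ⟨l, rfl⟩⟩
    | zero => exact ⟨zero_mem _, zero_mem _⟩
    | add m n _ _ hm hn =>
      obtain ⟨h1, h2⟩ := hm
      obtain ⟨h3, h4⟩ := hn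
      exact ⟨add_mem h1 h3, add_mem h2 h4⟩
    | smul r m _ hm =>
      obtain ⟨h1, h2⟩ := hm
      exact ⟨zsmul_mem h1 r, Submodule.smul_mem _ r h2⟩
  obtain ⟨hm', hmem⟩ := key
  have : augMk k x hx = augMk k m hm' := (augMk_eq_iff hx hm').2 hr
  change augMk k x hx ∈ _
  rw [this]
  exact hmem

/-- The basis of `I^k / I^{k+1}` consisting of the classes of the products
`(z_{j₁} - 1) ⋯ (z_{jₖ} - 1)`. -/
def augBasis (z : FreeGroupBasis J F) (k : ℕ) : Module.Basis (Fin k → J) ℤ (AugGr F k) :=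
  Module.Basis.mk (linearIndependent_monomial z k) (span_monomial z k)

/-- The linear map `I^k / I^{k+1} → H^{⊗ k}` sending the class of `(z_{j₁} - 1) ⋯ (z_{jₖ} - 1)` to
`[z_{j₁}] ⊗ ⋯ ⊗ [z_{jₖ}]`. -/
def iMap (z : FreeGroupBasis J F) (k : ℕ) : AugGr F k →ₗ[ℤ] ⨂[ℤ]^k (H F) :=
  (augBasis z k).constr ℤ fun j => PiTensorProduct.tprod ℤ fun s => toH (z (j s))

theorem iMap_monomial (z : FreeGroupBasis J F) (k : ℕ) (j : Fin k → J) :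
    iMap z k (augMk k (monomial z j) (monomial_mem z j)) =
      PiTensorProduct.tprod ℤ fun s => toH (z (j s)) := by
  have := (augBasis z k).constr_basis ℤ
    (fun j => PiTensorProduct.tprod ℤ fun s => toH (z (j s))) j
  rwa [augBasis, Module.Basis.mk_apply] at this

end Fox

/-! ### The lower central series -/

section LowerCentral

variable (F : Type u) [Group F]

/-- The lower central series `F₁ = F`, `F_{k+1} = [F_k, F]`, with the convention `F₀ = F`. -/
def lcs (k : ℕ) : Subgroup F := (⊤ : Subgroup F).lowerCentralSeries (k - 1)

theorem lcs_one : lcs F 1 = ⊤ := rfl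

theorem lcs_succ (k : ℕ) (hk : 1 ≤ k) : lcs F (k + 1) = ⁅lcs F k, (⊤ : Subgroup F)⁆ := by
  obtain ⟨k, rfl⟩ := Nat.exists_eq_add_of_le' hk
  rfl

instance (k : ℕ) : (lcs F k).Normal := by unfold lcs; infer_instance

/-- The quotient `F_k / F_{k+1}`. -/
abbrev LcsGr (k : ℕ) : Type u := ↥(lcs F k) ⧸ (lcs F (k + 1)).subgroupOf (lcs F k)

variable {F}

open scoped commutatorElement

theorem del_mul (g h : F) : del (g * h) = del g + del h + del g * del h := by
  simp only [del, map_mul]; noncomm_ring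

/-- `g - 1 ∈ I ^ k` for `g ∈ F_k`. -/
theorem del_mem_pow (k : ℕ) {g : F} (hg : g ∈ lcs F k) : del g ∈ augIdeal F ^ k := by
  induction k generalizing g with
  | zero => rw [Submodule.pow_zero, Ideal.one_eq_top]; trivial
  | succ k ih =>
    rcases Nat.eq_zero_or_pos k with rfl | hk
    · rw [zero_add, Submodule.pow_one]; exact del_mem g
    rw [lcs_succ F k hk, Subgroup.commutator_def] at hg
    induction hg using Subgroup.closure_induction with
    | mem g hg =>
      obtain ⟨a, ha, b, -, rfl⟩ := hg
      have h1 : del ⁅a, b⁆ = (del a * del b - del b * del a) * MonoidAlgebra.of ℤ F (a⁻¹ * b⁻¹) := by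
        have h2 : MonoidAlgebra.of ℤ F b * MonoidAlgebra.of ℤ F a *
            MonoidAlgebra.of ℤ F (a⁻¹ * b⁻¹) = 1 := by
          rw [← map_mul, ← map_mul, ← map_one (MonoidAlgebra.of ℤ F)]; congr 1; group
        have h3 : MonoidAlgebra.of ℤ F ⁅a, b⁆ = MonoidAlgebra.of ℤ F a * MonoidAlgebra.of ℤ F b *
            MonoidAlgebra.of ℤ F (a⁻¹ * b⁻¹) := by
          rw [← map_mul, ← map_mul, commutatorElement_def]; congr 1; group
        have h4 : del a * del b - del b * del a = MonoidAlgebra.of ℤ F a * MonoidAlgebra.of ℤ F b -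
            MonoidAlgebra.of ℤ F b * MonoidAlgebra.of ℤ F a := by
          simp only [del]; noncomm_ring
        rw [h4, sub_mul, h2, ← h3, del]
      rw [h1]
      refine Ideal.mul_mem_right _ _ (sub_mem ?_ ?_)
      · rw [Submodule.pow_succ]; exact Ideal.mul_mem_mul (ih ha) (del_mem b)
      · rw [Submodule.pow_succ' _ hk.ne']; exact Ideal.mul_mem_mul (del_mem b) (ih ha)
    | one => rw [del, map_one, sub_self]; exact zero_mem _
    | mul g h _ _ hg hh =>
      rw [del_mul]
      exact add_mem (add_mem hg hh) (Ideal.mul_mem_left _ _ hh)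
    | inv g _ hg =>
      have : del g⁻¹ = -(MonoidAlgebra.of ℤ F g⁻¹ * del g) := by
        rw [del, del, mul_sub, ← map_mul, inv_mul_cancel, map_one, mul_one]; abel
      rw [this]
      exact neg_mem (Ideal.mul_mem_left _ _ hg)

/-- The homomorphism `F_k → I^k / I^{k+1}`, `g ↦ [g - 1]`. -/
def psiHom (F : Type u) [Group F] (k : ℕ) : ↥(lcs F k) →* Multiplicative (AugGr F k) :=
  MonoidHom.mk' (fun g => Multiplicative.ofAdd (augMk k (del (g : F)) (del_mem_pow k g.2)))
    fun g h => by
      have h1 : augMk k (del ((g * h : ↥(lcs F k)) : F)) (del_mem_pow k (g * h).2) =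
          augMk k (del (g : F) + del (h : F))
            (add_mem (del_mem_pow k g.2) (del_mem_pow k h.2)) := by
        rw [augMk_eq_iff, Subgroup.coe_mul, del_mul, add_sub_cancel_left, Submodule.pow_succ]
        exact Ideal.mul_mem_mul (del_mem_pow k g.2) (del_mem _)
      rw [h1]
      rfl

/-- The homomorphism `ψ_k : F_k / F_{k+1} → I^k / I^{k+1}`, `[g] ↦ [g - 1]`. -/
def psi (F : Type u) [Group F] (k : ℕ) : LcsGr F k →* Multiplicative (AugGr F k) :=
  QuotientGroup.lift _ (psiHom F k) fun g hg => by
    have h1 : augMk k (del (g : F)) (del_mem_pow k g.2) = augMk k 0 (zero_mem _) := by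
      rw [augMk_eq_iff, sub_zero]
      exact del_mem_pow (k + 1) hg
    change Multiplicative.ofAdd (augMk k (del (g : F)) (del_mem_pow k g.2)) = 1
    rw [h1]
    rfl

theorem psi_mk (k : ℕ) (g : ↥(lcs F k)) :
    psi F k (QuotientGroup.mk g) =
      Multiplicative.ofAdd (augMk k (del (g : F)) (del_mem_pow k g.2)) := rfl

end LowerCentral

/-! ### The bi-ordering of a free group associated with an ordered basis of `H ⊗ ℝ` -/

section Order

variable {F : Type u} [Group F] {J : Type v} {I : Type w} [LinearOrder I]

/-- The composite `j_k ∘ i_k ∘ ψ_k : F_k / F_{k+1} → (H ⊗ ℝ)^{⊗ k}`. -/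
def gradedMap (z : FreeGroupBasis J F) (k : ℕ) (a : LcsGr F k) : ⨂[ℝ]^k (HR F) :=
  jMap F k (iMap z k (Multiplicative.toAdd (psi F k a)))

/-- The ordering `<_k` of `F_k / F_{k+1}`. -/
def GradedLT (z : FreeGroupBasis J F) (B : Module.Basis I ℝ (HR F)) (k : ℕ)
    (a b : LcsGr F k) : Prop :=
  LexLT (tensorPowerBasis B k) (gradedMap z k a) (gradedMap z k b)

/-- `a` is positive: for the largest `k` with `a ∈ F_k`, the class of `a` in `F_k / F_{k+1}`
is greater than `1` with respect to `<_k`. -/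
def AssocPos (z : FreeGroupBasis J F) (B : Module.Basis I ℝ (HR F)) (a : F) : Prop :=
  ∃ (k : ℕ) (hk : IsGreatest {n : ℕ | a ∈ lcs F n} k),
    GradedLT z B k 1 (QuotientGroup.mk (⟨a, hk.1⟩ : ↥(lcs F k)))

/-- The ordering of the free group `F` (with free basis `z`) associated with the ordered basis
`B` of `H ⊗ ℝ`. -/
def AssocLT (z : FreeGroupBasis J F) (B : Module.Basis I ℝ (HR F)) (a b : F) : Prop :=
  AssocPos z B (a⁻¹ * b)

end Order

end FreeGroupOrder

end

/-!
The ordering comes from the graded maps `F_k / F_{k+1} → (H ⊗ ℝ)^{⊗ k}`: the image of `a ∈ F_k`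
(`leadingTensor`) is additive in `a` and unchanged by conjugation, so that positivity of `a` is
preserved by products and conjugation. That the ordering is total amounts to two theorems of Magnus.

* Free groups are residually nilpotent (`eq_one_of_forall_mem_lcs`). The free generators act on
  functions on words by operators `1 + E_i` with `E_i ^ 2 = 0` that prepend the letter `i`. An
  element of `⋂ F_n` then acts trivially on the empty word, but a nonempty reduced word does not.

* The graded maps are injective (`leadingTensor_eq_zero_iff`). The commutator turns
  `⨁ F_k / F_{k+1}` into a Lie ring generated by the classes of a free basis, and the graded maps
  become a Lie homomorphism to the tensor algebra of `H`, which is free on the images of these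
  generators. Any such homomorphism is injective (`eq_zero_of_mem_closure_isLieMonomial`). This is
  shown by Lazard elimination: up to a multiple of the generator `x`, a Lie element is a Lie element
  in the letters `ad(x)^i y`, `y ≠ x`, which again generate a free associative algebra. The
  elimination of all the letters that occur in the longest monomials shortens these monomials, so
  that induction applies. The point of this argument is that neither a basis of the free Lie ring
  nor the Poincaré-Birkhoff-Witt theorem is needed.

The symbol of a product `(g_1 - 1) ⋯ (g_k - 1)` is `[g_1] ⊗ ⋯ ⊗ [g_k]` for arbitrary `g_i ∈ F`
(`symbol_monomial_id`), not only for basis elements. Hence the graded maps do not depend on the free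
basis and commute with automorphisms. Finally, the tensor powers of a positively triangular map are
positively triangular for the lexicographically ordered tensor basis, because the coefficients of
a tensor product of vectors are the products of their coefficients (`LexPos.map_tensorPower`).
-/

namespace FreeGroupOrder

noncomputable section

/-! ### Lie elimination -/

section Elimination

universe u v w

variable {X : Type u} {L : Type v} [LieRing L]

/-- `IsLieMonomial g S n a`: the element `a` is an iterated bracket of `n` of the elements `g x`
with `x ∈ S`. -/
inductive IsLieMonomial (g : X → L) (S : Set X) : ℕ → L → Prop
  | letter (x : X) (hx : x ∈ S) : IsLieMonomial g S 1 (g x)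
  | lie (m n : ℕ) (a b : L) (ha : IsLieMonomial g S m a) (hb : IsLieMonomial g S n b) :
      IsLieMonomial g S (m + n) ⁅a, b⁆

theorem IsLieMonomial.pos {g : X → L} {S : Set X} {n : ℕ} {a : L} (h : IsLieMonomial g S n a) :
    0 < n := by
  induction h with
  | letter => exact Nat.one_pos
  | lie m n a b _ _ iha _ => omega

theorem IsLieMonomial.mono {g : X → L} {S T : Set X} (hST : S ⊆ T) {n : ℕ} {a : L}
    (h : IsLieMonomial g S n a) : IsLieMonomial g T n a := by
  induction h with
  | letter x hx => exact .letter x (hST hx)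
  | lie m n a b _ _ iha ihb => exact .lie m n a b iha ihb

theorem IsLieMonomial.exists_finset {g : X → L} {S : Set X} {n : ℕ} {a : L}
    (h : IsLieMonomial g S n a) : ∃ A : Finset X, IsLieMonomial g A n a := by
  classical
  induction h with
  | letter x hx => exact ⟨{x}, .letter x (by simp)⟩
  | lie m n a b _ _ iha ihb =>
    obtain ⟨A, hA⟩ := iha
    obtain ⟨B, hB⟩ := ihb
    exact ⟨A ∪ B, .lie m n a b (hA.mono (by simp)) (hB.mono (by simp))⟩

theorem not_isLieMonomial_empty {g : X → L} {n : ℕ} {a : L} : ¬ IsLieMonomial g ∅ n a := by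
  intro h
  induction h with
  | letter x hx => exact hx
  | lie _ _ _ _ _ _ iha _ => exact iha

/-- The additive group generated by the Lie monomials of length less than `n` in all letters and
those of length `n` in the letters from `S`. -/
def lieSpan (g : X → L) (n : ℕ) (S : Set X) : AddSubgroup L :=
  AddSubgroup.closure
    {a | (∃ k < n, IsLieMonomial g Set.univ k a) ∨ IsLieMonomial g S n a}

theorem lieSpan_mono (g : X → L) (n : ℕ) {S T : Set X} (h : S ⊆ T) :
    lieSpan g n S ≤ lieSpan g n T :=
  AddSubgroup.closure_mono fun _ ha => ha.imp_right fun ha => ha.mono h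

theorem IsLieMonomial.mem_lieSpan_of_lt {g : X → L} {S T : Set X} {k n : ℕ} {a : L}
    (h : IsLieMonomial g S k a) (hkn : k < n) : a ∈ lieSpan g n T :=
  AddSubgroup.subset_closure (Or.inl ⟨k, hkn, h.mono (Set.subset_univ _)⟩)

theorem IsLieMonomial.mem_lieSpan {g : X → L} {S : Set X} {n : ℕ} {a : L}
    (h : IsLieMonomial g S n a) : a ∈ lieSpan g n S :=
  AddSubgroup.subset_closure (Or.inr h)

theorem lieSpan_le_of_lt (g : X → L) {m n : ℕ} (hmn : m < n) (S T : Set X) :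
    lieSpan g m S ≤ lieSpan g n T := by
  refine (AddSubgroup.closure_le _).2 fun a ha => ?_
  rcases ha with ⟨k, hk, ha⟩ | ha
  · exact ha.mem_lieSpan_of_lt (hk.trans hmn)
  · exact ha.mem_lieSpan_of_lt hmn

theorem lie_mem_lieSpan {g : X → L} {m n : ℕ} {S : Set X} {a b : L}
    (ha : a ∈ lieSpan g m S) (hb : b ∈ lieSpan g n S) : ⁅a, b⁆ ∈ lieSpan g (m + n) S := by
  induction ha using AddSubgroup.closure_induction with
  | mem a ha =>
    induction hb using AddSubgroup.closure_induction with
    | mem b hb =>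
      rcases ha with ⟨k, hk, ha⟩ | ha <;> rcases hb with ⟨l, hl, hb⟩ | hb
      · exact (ha.lie _ _ _ _ hb).mem_lieSpan_of_lt (by omega)
      · exact (ha.lie _ _ _ _ (hb.mono (Set.subset_univ _))).mem_lieSpan_of_lt (by omega)
      · exact ((ha.mono (Set.subset_univ _)).lie _ _ _ _ hb).mem_lieSpan_of_lt (by omega)
      · exact (ha.lie _ _ _ _ hb).mem_lieSpan
    | zero => rw [lie_zero]; exact zero_mem _
    | add b c _ _ hb hc => rw [lie_add]; exact add_mem hb hc
    | neg b _ hb => rw [lie_neg]; exact neg_mem hb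
  | zero => rw [zero_lie]; exact zero_mem _
  | add a c _ _ ha hc => rw [add_lie]; exact add_mem ha hc
  | neg a _ ha => rw [neg_lie]; exact neg_mem ha

theorem exists_finset_mem_lieSpan {g : X → L} {n : ℕ} {a : L}
    (ha : a ∈ lieSpan g (n + 1) ∅) : ∃ A : Finset X, a ∈ lieSpan g n A := by
  classical
  induction ha using AddSubgroup.closure_induction with
  | mem a ha =>
    rcases ha with ⟨k, hk, ha⟩ | ha
    · rcases Nat.lt_succ_iff_lt_or_eq.1 hk with hk | rfl
      · exact ⟨∅, ha.mem_lieSpan_of_lt hk⟩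
      · obtain ⟨A, hA⟩ := ha.exists_finset
        exact ⟨A, hA.mem_lieSpan⟩
    · exact (not_isLieMonomial_empty ha).elim
  | zero => exact ⟨∅, zero_mem _⟩
  | add a b _ _ ha hb =>
    obtain ⟨A, hA⟩ := ha
    obtain ⟨B, hB⟩ := hb
    exact ⟨A ∪ B, add_mem (lieSpan_mono g n (by simp) hA) (lieSpan_mono g n (by simp) hB)⟩
  | neg a _ ha =>
    obtain ⟨A, hA⟩ := ha
    exact ⟨A, neg_mem hA⟩

/-- The letters that remain after the elimination of `x`: the pair `(i, y)` with `y ≠ x` stands for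
`ad(x)^i y`. -/
abbrev Elim (x : X) : Type u := ℕ × {y : X // y ≠ x}

/-- The family of the elements `ad(g x)^i (g y)`, `y ≠ x`. -/
def elim {L : Type v} [Bracket L L] (g : X → L) (x : X) (p : Elim x) : L :=
  (fun a => ⁅g x, a⁆)^[p.1] (g p.2)

theorem lie_elim {L : Type v} [Bracket L L] (g : X → L) (x : X) (p : Elim x) :
    ⁅g x, elim g x p⁆ = elim g x (p.1 + 1, p.2) := by
  simp only [elim, Function.iterate_succ_apply']

theorem lie_isLieMonomial_elim {g : X → L} {x : X} {S : Set (Elim x)} {k : ℕ} {a : L}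
    (ha : IsLieMonomial (elim g x) S k a) :
    ⁅g x, a⁆ ∈ lieSpan (elim g x) k Set.univ := by
  induction ha with
  | letter p hp => rw [lie_elim]; exact (IsLieMonomial.letter _ (Set.mem_univ _)).mem_lieSpan
  | lie m n a b ha hb iha ihb =>
    rw [leibniz_lie]
    exact add_mem (lie_mem_lieSpan iha (hb.mono (Set.subset_univ _)).mem_lieSpan)
      (lie_mem_lieSpan (ha.mono (Set.subset_univ _)).mem_lieSpan ihb)

theorem lie_mem_lieSpan_elim {g : X → L} {x : X} {S T : Set (Elim x)} {m n : ℕ} (hmn : m < n)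
    {a : L} (ha : a ∈ lieSpan (elim g x) m S) : ⁅g x, a⁆ ∈ lieSpan (elim g x) n T := by
  induction ha using AddSubgroup.closure_induction with
  | mem a ha =>
    rcases ha with ⟨k, hk, ha⟩ | ha
    · exact lieSpan_le_of_lt _ (hk.trans hmn) _ _ (lie_isLieMonomial_elim ha)
    · exact lieSpan_le_of_lt _ hmn _ _ (lie_isLieMonomial_elim ha)
  | zero => rw [lie_zero]; exact zero_mem _
  | add a c _ _ ha hc => rw [lie_add]; exact add_mem ha hc
  | neg a _ ha => rw [lie_neg]; exact neg_mem ha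

/-- Elimination of the letter `x`: a Lie monomial of length `n` is, up to a multiple of `x`,
a combination of Lie monomials of length at most `n` in the letters `ad(x)^i y`, and those of length
exactly `n` only involve letters with `i = 0`. -/
theorem IsLieMonomial.exists_elim {g : X → L} (x : X) {S : Set X} {n : ℕ} {a : L}
    (ha : IsLieMonomial g S n a) :
    ∃ c : ℤ, a - c • g x ∈ lieSpan (elim g x) n {p | p.1 = 0 ∧ (p.2 : X) ∈ S} := by
  induction ha with
  | letter y hy =>
    by_cases hxy : y = x
    · subst hxy
      exact ⟨1, by rw [one_smul, sub_self]; exact zero_mem _⟩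
    · refine ⟨0, ?_⟩
      rw [zero_smul, sub_zero]
      exact (IsLieMonomial.letter (g := elim g x) (S := {p | p.1 = 0 ∧ (p.2 : X) ∈ S})
        (0, ⟨y, hxy⟩) ⟨rfl, hy⟩).mem_lieSpan
  | lie m n a b ha hb iha ihb =>
    obtain ⟨c, hc⟩ := iha
    obtain ⟨d, hd⟩ := ihb
    refine ⟨0, ?_⟩
    have h : ⁅a, b⁆ - (0 : ℤ) • g x = ⁅a - c • g x, b - d • g x⁆ + c • ⁅g x, b - d • g x⁆ -
        d • ⁅g x, a - c • g x⁆ := by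
      rw [← lie_skew (g x) (a - c • g x)]
      simp only [sub_lie, lie_sub, zsmul_lie, lie_zsmul, lie_self, smul_zero, zero_smul, sub_zero,
        smul_neg]
      abel
    rw [h]
    exact sub_mem (add_mem (lie_mem_lieSpan hc hd)
      (zsmul_mem (lie_mem_lieSpan_elim (Nat.lt_add_of_pos_left ha.pos) hd) c))
      (zsmul_mem (lie_mem_lieSpan_elim (Nat.lt_add_of_pos_right hb.pos) hc) d)

theorem exists_elim_of_mem_lieSpan {g : X → L} (x : X) {S : Set X} {n : ℕ} {a : L}
    (ha : a ∈ lieSpan g n S) :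
    ∃ c : ℤ, a - c • g x ∈ lieSpan (elim g x) n {p | p.1 = 0 ∧ (p.2 : X) ∈ S} := by
  induction ha using AddSubgroup.closure_induction with
  | mem a ha =>
    rcases ha with ⟨k, hk, ha⟩ | ha
    · obtain ⟨c, hc⟩ := ha.exists_elim x
      exact ⟨c, lieSpan_le_of_lt _ hk _ _ hc⟩
    · exact ha.exists_elim x
  | zero => exact ⟨0, by rw [zero_smul, sub_zero]; exact zero_mem _⟩
  | add a b _ _ ha hb =>
    obtain ⟨c, hc⟩ := ha
    obtain ⟨d, hd⟩ := hb
    exact ⟨c + d, by rw [add_smul, add_sub_add_comm]; exact add_mem hc hd⟩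
  | neg a _ ha =>
    obtain ⟨c, hc⟩ := ha
    refine ⟨-c, ?_⟩
    have h : -a - -c • g x = -(a - c • g x) := by rw [neg_smul]; abel
    rw [h]
    exact neg_mem hc

/-- The free associative algebra on the letters that remain after the elimination of `x`. -/
abbrev ElimAlgebra (R : Type w) [CommRing R] (x : X) : Type (max u w) := FreeAlgebra R (Elim x)

/-- The free algebra on `Elim x` has a derivation sending the letter `(i, y)` to `(i + 1, y)`. It is
read off from an algebra homomorphism to the trivial square-zero extension. -/
theorem exists_elim_derivation (R : Type w) [CommRing R] (x : X) :
    ∃ D : Module.End R (ElimAlgebra R x), (∀ p q, D (p * q) = D p * q + p * D q) ∧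
      ∀ p : Elim x, D (FreeAlgebra.ι R p) = FreeAlgebra.ι R (p.1 + 1, p.2) := by
  let Λ : ElimAlgebra R x →ₐ[R] TrivSqZeroExt (ElimAlgebra R x) (ElimAlgebra R x) :=
    FreeAlgebra.lift R fun p : Elim x => TrivSqZeroExt.inl (FreeAlgebra.ι R p) +
      TrivSqZeroExt.inr (FreeAlgebra.ι R ((p.1 + 1, p.2) : Elim x))
  have hfst : ∀ p, (Λ p).fst = p := by
    have h : (TrivSqZeroExt.fstHom R (ElimAlgebra R x) (ElimAlgebra R x)).comp Λ =
        AlgHom.id R (ElimAlgebra R x) := by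
      ext p
      simp [Λ]
    exact fun p => DFunLike.congr_fun h p
  refine ⟨{ toFun := fun p => (Λ p).snd, map_add' := by simp, map_smul' := by simp },
    fun p q => ?_, fun p => ?_⟩
  · change (Λ (p * q)).snd = (Λ p).snd * q + p * (Λ q).snd
    rw [map_mul, TrivSqZeroExt.snd_mul, hfst, hfst, smul_eq_mul, op_smul_eq_mul, add_comm]
  · change (Λ _).snd = _
    simp [Λ]

/-- If the letter `x` of the free algebra on `X` is made to act on the free algebra on `Elim x` by
the shift derivation, and the letter `y ≠ x` by left multiplication by `(0, y)`, then `ad(x)^i y`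
acts by left multiplication by `(i, y)`. So an element of the subalgebra generated by the
`ad(x)^i y` is recovered from its action on `1`, on which `x` vanishes. -/
theorem eq_zero_of_smul_add_lift_elim {R : Type w} [CommRing R] (x : X) (c : ℤ)
    (p : ElimAlgebra R x)
    (h : (c : FreeAlgebra R X) * FreeAlgebra.ι R x +
      FreeAlgebra.lift R (elim (FreeAlgebra.ι R) x) p = 0) :
    p = 0 := by
  classical
  obtain ⟨D, hD, hDι⟩ := exists_elim_derivation R x
  let ρ : FreeAlgebra R X →ₐ[R] Module.End R (ElimAlgebra R x) := FreeAlgebra.lift R fun y =>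
    if hy : y = x then D else LinearMap.mulLeft R (FreeAlgebra.ι R ((0, ⟨y, hy⟩) : Elim x))
  have hρx : ρ (FreeAlgebra.ι R x) = D := by simp [ρ]
  have hρ : ∀ (i : ℕ) (y : {y : X // y ≠ x}), ρ (elim (FreeAlgebra.ι R) x (i, y)) =
      LinearMap.mulLeft R (FreeAlgebra.ι R ((i, y) : Elim x)) := by
    intro i y
    induction i with
    | zero => simp [ρ, elim, y.2]
    | succ i ih =>
      have h1 := lie_elim (FreeAlgebra.ι R) x (i, y)
      rw [← h1, Ring.lie_def, map_sub, map_mul, map_mul, ih, hρx]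
      ext q : 1
      have h2 := hDι (i, y)
      simp only [LinearMap.sub_apply, Module.End.mul_apply, LinearMap.mulLeft_apply, hD, h2]
      abel
  have hcomp : ρ.comp (FreeAlgebra.lift R (elim (FreeAlgebra.ι R) x)) =
      Algebra.lmul R (ElimAlgebra R x) := by
    ext p : 2
    obtain ⟨i, y⟩ := p
    simp only [Function.comp_apply, AlgHom.comp_apply, FreeAlgebra.lift_ι_apply, hρ]
    rfl
  have hD1 : D 1 = 0 := by
    have := hD 1 1
    rw [mul_one, mul_one, one_mul] at this
    exact left_eq_add.1 this
  have h1 : ρ (FreeAlgebra.lift R (elim (FreeAlgebra.ι R) x) p) 1 = p := by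
    have h2 := DFunLike.congr_fun (DFunLike.congr_fun hcomp p) (1 : ElimAlgebra R x)
    simpa using h2
  have h3 := congrArg (fun r => ρ r 1) h
  simp only [map_add, map_mul, map_intCast, hρx, LinearMap.add_apply, Module.End.mul_apply, hD1,
    zero_add, map_zero, LinearMap.zero_apply, h1] at h3
  exact h3

variable {A : Type w} [Ring A] [Algebra ℤ A] (θ : L →+ A)
  (hθ : ∀ a b, θ ⁅a, b⁆ = θ a * θ b - θ b * θ a)

include hθ in
theorem map_mem_range_lift {g : X → L} {n : ℕ} {S : Set X} {a : L} (ha : a ∈ lieSpan g n S) :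
    θ a ∈ (FreeAlgebra.lift ℤ fun x => θ (g x)).range := by
  have hmono : ∀ {k : ℕ} {S : Set X} {a : L}, IsLieMonomial g S k a →
      θ a ∈ (FreeAlgebra.lift ℤ fun x => θ (g x)).range := by
    intro k S a ha
    induction ha with
    | letter x _ => exact ⟨FreeAlgebra.ι ℤ x, by simp⟩
    | lie m n a b _ _ iha ihb =>
      rw [hθ]
      exact sub_mem (mul_mem iha ihb) (mul_mem ihb iha)
  induction ha using AddSubgroup.closure_induction with
  | mem a ha =>
    rcases ha with ⟨k, -, ha⟩ | ha
    · exact hmono ha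
    · exact hmono ha
  | zero => rw [map_zero]; exact zero_mem _
  | add a b _ _ ha hb => rw [map_add]; exact add_mem ha hb
  | neg a _ ha => rw [map_neg]; exact neg_mem ha

include hθ in
/-- Lie elimination, by induction on the length `n` and the number of letters that occur
in the monomials of maximal length. -/
theorem eq_zero_of_mem_lieSpan (n : ℕ) : ∀ (k : ℕ) {X : Type u} (g : X → L),
    Function.Injective (FreeAlgebra.lift ℤ fun x => θ (g x)) → ∀ S : Finset X, S.card = k →
      ∀ a ∈ lieSpan g n S, θ a = 0 → a = 0 := by
  classical
  induction n with
  | zero =>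
    intro k X g _ S _ a ha _
    have h : lieSpan g 0 (S : Set X) = ⊥ := by
      rw [lieSpan, AddSubgroup.closure_eq_bot_iff]
      rintro a (⟨k, hk, -⟩ | ha)
      · exact (Nat.not_lt_zero _ hk).elim
      · exact (lt_irrefl _ ha.pos).elim
    rwa [h, AddSubgroup.mem_bot] at ha
  | succ n ihn =>
    intro k
    induction k with
    | zero =>
      intro X g hg S hS a ha h0
      rw [Finset.card_eq_zero.1 hS, Finset.coe_empty] at ha
      -- all letters are eliminated from the monomials of maximal length, and the length drops
      obtain ⟨A, hA⟩ := exists_finset_mem_lieSpan ha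
      exact ihn _ g hg A rfl a hA h0
    | succ k ihk =>
      intro X g hg S hS a ha h0
      obtain ⟨x, hx⟩ : S.Nonempty := Finset.card_pos.1 (by omega)
      obtain ⟨c, hc⟩ := exists_elim_of_mem_lieSpan x ha
      let S' : Finset (Elim x) :=
        (S.subtype (· ≠ x)).map ⟨fun y => (0, y), fun y z h => (Prod.ext_iff.1 h).2⟩
      have hS' : {p : Elim x | p.1 = 0 ∧ (p.2 : X) ∈ (S : Set X)} = S' := by
        ext ⟨i, y⟩
        constructor
        · rintro ⟨rfl, hy⟩
          exact Finset.mem_coe.2 (Finset.mem_map.2 ⟨y, Finset.mem_subtype.2 hy, rfl⟩)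
        · intro h
          obtain ⟨w, hw, h'⟩ := Finset.mem_map.1 (Finset.mem_coe.1 h)
          obtain ⟨rfl, rfl⟩ := Prod.ext_iff.1 h'
          exact ⟨rfl, Finset.mem_subtype.1 hw⟩
      have hcard : S'.card = k := by
        rw [Finset.card_map, Finset.card_subtype, Finset.filter_ne',
          Finset.card_erase_of_mem hx, hS]
        rfl
      have hcomp : (FreeAlgebra.lift ℤ fun p => θ (elim g x p)) =
          (FreeAlgebra.lift ℤ fun x => θ (g x)).comp
            (FreeAlgebra.lift ℤ (elim (FreeAlgebra.ι ℤ) x)) := by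
        ext ⟨i, y⟩
        simp only [Function.comp_apply, AlgHom.comp_apply, FreeAlgebra.lift_ι_apply]
        induction i with
        | zero => simp [elim]
        | succ i ih =>
          have h1 := lie_elim (FreeAlgebra.ι ℤ) x (i, y)
          have h2 := lie_elim g x (i, y)
          rw [← h1, ← h2, hθ, ih, Ring.lie_def, map_sub, map_mul, map_mul, FreeAlgebra.lift_ι_apply]
      have hinj : Function.Injective (FreeAlgebra.lift ℤ fun p => θ (elim g x p)) := by
        rw [hcomp, AlgHom.coe_comp]
        refine hg.comp ((injective_iff_map_eq_zero _).2 fun p hp => ?_)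
        exact eq_zero_of_smul_add_lift_elim x 0 p (by rw [Int.cast_zero, zero_mul, zero_add, hp])
      -- the relation `θ a = 0` holds already in the free algebra, which kills the Lie element
      -- in the letters `Elim x` and then the multiple of `x`
      obtain ⟨p, hp⟩ := map_mem_range_lift θ hθ hc
      have hp' : p = 0 := by
        refine eq_zero_of_smul_add_lift_elim x c p (hg ?_)
        rw [map_add, map_mul, map_intCast, FreeAlgebra.lift_ι_apply, map_zero,
          ← AlgHom.comp_apply, ← hcomp]
        change _ + (FreeAlgebra.lift ℤ fun p => θ (elim g x p)).toRingHom p = 0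
        rw [hp, map_sub, map_zsmul, h0, zsmul_eq_mul]
        simp
      have h1 : a - c • g x = 0 := by
        rw [hS'] at hc
        refine ihk _ hinj S' hcard _ hc ?_
        rw [← hp, hp', map_zero]
      have h2 : (c : FreeAlgebra ℤ X) * FreeAlgebra.ι ℤ x = 0 := by
        apply hg
        rw [map_mul, map_intCast, FreeAlgebra.lift_ι_apply, map_zero, ← zsmul_eq_mul,
          ← map_zsmul, ← sub_eq_zero.1 h1, h0]
      have h3 : c = 0 := by
        have h4 := congrArg (FreeAlgebra.lift ℤ fun _ => (1 : ℤ)) h2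
        simpa using h4
      rw [sub_eq_zero.1 h1, h3, zero_smul]

include hθ in
/-- If the associative algebra generated by the `θ (g x)` is free, then `θ` is injective on the Lie
ring generated by the `g x`. -/
theorem eq_zero_of_mem_closure_isLieMonomial {g : X → L}
    (hg : Function.Injective (FreeAlgebra.lift ℤ fun x => θ (g x))) {a : L}
    (ha : a ∈ AddSubgroup.closure {a | ∃ n, IsLieMonomial g Set.univ n a}) (h0 : θ a = 0) :
    a = 0 := by
  obtain ⟨n, hn⟩ : ∃ n, a ∈ lieSpan g n ∅ := by
    clear h0
    induction ha using AddSubgroup.closure_induction with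
    | mem a ha =>
      obtain ⟨n, hn⟩ := ha
      exact ⟨n + 1, hn.mem_lieSpan_of_lt n.lt_succ_self⟩
    | zero => exact ⟨0, zero_mem _⟩
    | add a b _ _ ha hb =>
      obtain ⟨m, hm⟩ := ha
      obtain ⟨n, hn⟩ := hb
      exact ⟨m + n + 1, add_mem (lieSpan_le_of_lt g (by omega) _ _ hm)
        (lieSpan_le_of_lt g (by omega) _ _ hn)⟩
    | neg a _ ha =>
      obtain ⟨n, hn⟩ := ha
      exact ⟨n, neg_mem hn⟩
  refine eq_zero_of_mem_lieSpan θ hθ n 0 g hg ∅ rfl a ?_ h0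
  rwa [Finset.coe_empty]

end Elimination

/-! ### Residual nilpotence -/

section Residual

universe u v

variable {F : Type u} [Group F] {J : Type v}

open Classical in
/-- The operator on functions on words that sends the indicator of a word `t` to the indicator
of `i :: t` if `t` does not begin with `i`, and to zero otherwise. It has square zero. -/
def shift (i : J) : Module.End ℤ (List J → ℤ) where
  toFun v
    | [] => 0
    | a :: t => if a = i ∧ t.head? ≠ some i then v t else 0
  map_add' v w := by
    funext l
    cases l with
    | nil => simp
    | cons a t => simp only [Pi.add_apply]; split_ifs <;> simp
  map_smul' r v := by
    funext l
    cases l with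
    | nil => simp
    | cons a t => simp

theorem shift_cons (i : J) (v : List J → ℤ) {t : List J} (ht : t.head? ≠ some i) :
    shift i v (i :: t) = v t := by
  simp [shift, ht]

theorem shift_of_head?_ne (i : J) (v : List J → ℤ) {l : List J} (hl : l.head? ≠ some i) :
    shift i v l = 0 := by
  cases l with
  | nil => rfl
  | cons a t => exact if_neg fun h => hl (by rw [h.1]; rfl)

theorem shift_mul_shift (i : J) : shift i * shift i = 0 := by
  ext1 v
  funext l
  cases l with
  | nil => rfl
  | cons a t =>
    by_cases h : a = i ∧ t.head? ≠ some i
    · obtain ⟨rfl, ht⟩ := h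
      rw [Module.End.mul_apply, shift_cons _ _ ht, shift_of_head?_ne _ _ ht]
      rfl
    · exact if_neg h

/-- The functions on words that vanish on the words of length less than `n`. -/
def longWords (J : Type v) (n : ℕ) : Submodule ℤ (List J → ℤ) where
  carrier := {v | ∀ l : List J, l.length < n → v l = 0}
  zero_mem' _ _ := rfl
  add_mem' hv hw l hl := by rw [Pi.add_apply, hv l hl, hw l hl, add_zero]
  smul_mem' r v hv l hl := by rw [Pi.smul_apply, hv l hl, smul_zero]

theorem longWords_succ_le (n : ℕ) : longWords J (n + 1) ≤ longWords J n :=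
  fun _ hv l hl => hv l (hl.trans n.lt_succ_self)

theorem shift_mem (i : J) {n : ℕ} {v : List J → ℤ} (hv : v ∈ longWords J n) :
    shift i v ∈ longWords J (n + 1) := by
  intro l hl
  cases l with
  | nil => rfl
  | cons a t =>
    simp only [shift, LinearMap.coe_mk, AddHom.coe_mk]
    rw [hv t (by simpa using hl), ite_self]

/-- The unipotent operator `1 + shift i`. -/
def shiftUnit (i : J) : (Module.End ℤ (List J → ℤ))ˣ where
  val := 1 + shift i
  inv := 1 - shift i
  val_inv := by
    have := shift_mul_shift i
    rw [add_mul, mul_sub, mul_sub, one_mul, one_mul, mul_one, this]; abel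
  inv_val := by
    have := shift_mul_shift i
    rw [sub_mul, mul_add, mul_add, one_mul, one_mul, mul_one, this]; abel

/-- The representation of the free group `F` in which `z i` acts by `1 + shift i`. -/
def wordRep (z : FreeGroupBasis J F) : F →* Module.End ℤ (List J → ℤ) :=
  (Units.coeHom _).comp (z.lift shiftUnit)

theorem wordRep_basis (z : FreeGroupBasis J F) (i : J) : wordRep z (z i) = 1 + shift i := by
  have h : z.lift shiftUnit (z i) = shiftUnit i := by simp
  rw [wordRep, MonoidHom.comp_apply, h]
  rfl

theorem wordRep_basis_inv (z : FreeGroupBasis J F) (i : J) :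
    wordRep z (z i)⁻¹ = 1 - shift i := by
  have h : z.lift shiftUnit (z i) = shiftUnit i := by simp
  rw [wordRep, MonoidHom.comp_apply, map_inv, h]
  rfl

theorem wordRep_sub_mem (z : FreeGroupBasis J F) (g : F) {n : ℕ} {v : List J → ℤ}
    (hv : v ∈ longWords J n) : wordRep z g v - v ∈ longWords J (n + 1) := by
  have hg : g ∈ Subgroup.closure (Set.range z) := by rw [closure_range_basis]; trivial
  have key : (∀ n, ∀ v ∈ longWords J n, wordRep z g v - v ∈ longWords J (n + 1)) ∧
      ∀ n, ∀ v ∈ longWords J n, wordRep z g⁻¹ v - v ∈ longWords J (n + 1) := by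
    have hmul : ∀ g h : F, (∀ n, ∀ v ∈ longWords J n, wordRep z g v - v ∈ longWords J (n + 1)) →
        (∀ n, ∀ v ∈ longWords J n, wordRep z h v - v ∈ longWords J (n + 1)) →
        ∀ n, ∀ v ∈ longWords J n, wordRep z (g * h) v - v ∈ longWords J (n + 1) := by
      intro g h hg hh n v hv
      have h1 := hh n v hv
      have h2 : wordRep z h v ∈ longWords J n := by
        have := add_mem (longWords_succ_le n h1) hv
        rwa [sub_add_cancel] at this
      have h3 := add_mem (hg n _ h2) h1
      rwa [sub_add_sub_cancel, ← Module.End.mul_apply, ← map_mul] at h3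
    induction hg using Subgroup.closure_induction with
    | mem g hg =>
      obtain ⟨j, rfl⟩ := hg
      constructor
      · intro n v hv
        rw [wordRep_basis, LinearMap.add_apply, Module.End.one_apply, add_sub_cancel_left]
        exact shift_mem j hv
      · intro n v hv
        rw [wordRep_basis_inv, LinearMap.sub_apply, Module.End.one_apply, sub_sub_cancel_left]
        exact neg_mem (shift_mem j hv)
    | one => simp [zero_mem]
    | mul g h _ _ hg hh =>
      refine ⟨hmul g h hg.1 hh.1, ?_⟩
      rw [mul_inv_rev]
      exact hmul _ _ hh.2 hg.2
    | inv g _ hg => rw [inv_inv]; exact ⟨hg.2, hg.1⟩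
  exact key.1 n v hv

/-- The extension of `wordRep` to the integral group ring. -/
def wordAlgRep (z : FreeGroupBasis J F) : MonoidAlgebra ℤ F →ₐ[ℤ] Module.End ℤ (List J → ℤ) :=
  MonoidAlgebra.lift ℤ _ F (wordRep z)

theorem wordAlgRep_of (z : FreeGroupBasis J F) (g : F) :
    wordAlgRep z (MonoidAlgebra.of ℤ F g) = wordRep z g := by
  simp [wordAlgRep]

theorem wordAlgRep_sub_mem (z : FreeGroupBasis J F) (x : MonoidAlgebra ℤ F) {n : ℕ}
    {v : List J → ℤ} (hv : v ∈ longWords J n) :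
    wordAlgRep z x v - aug F x • v ∈ longWords J (n + 1) := by
  induction x using MonoidAlgebra.induction_on with
  | of g => rw [wordAlgRep_of, aug_of, one_smul]; exact wordRep_sub_mem z g hv
  | add x y hx hy =>
    rw [map_add, map_add, LinearMap.add_apply, add_smul, add_sub_add_comm]
    exact add_mem hx hy
  | smul r x hx =>
    rw [map_smul, map_smul, LinearMap.smul_apply, smul_assoc, ← smul_sub]
    exact Submodule.smul_mem _ r hx

theorem wordAlgRep_mem (z : FreeGroupBasis J F) {k : ℕ} {x : MonoidAlgebra ℤ F}
    (hx : x ∈ augIdeal F ^ k) {n : ℕ} {v : List J → ℤ} (hv : v ∈ longWords J n) :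
    wordAlgRep z x v ∈ longWords J (k + n) := by
  induction k generalizing x n v with
  | zero =>
    have := add_mem (longWords_succ_le n (wordAlgRep_sub_mem z x hv))
      (Submodule.smul_mem _ (aug F x) hv)
    rwa [sub_add_cancel, ← zero_add n] at this
  | succ k ih =>
    rw [Submodule.pow_succ] at hx
    refine Submodule.smul_induction_on hx (fun a ha b hb => ?_) fun a b ha hb => ?_
    · have h1 := wordAlgRep_sub_mem z b hv
      rw [mem_augIdeal.1 hb, zero_smul, sub_zero] at h1
      have h2 := ih ha h1
      rwa [← Module.End.mul_apply, ← map_mul, add_comm n 1, ← add_assoc] at h2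
    · rw [map_add]
      exact add_mem ha hb

/-- The indicator function of the empty word. -/
def emptyWord (J : Type v) : List J → ℤ
  | [] => 1
  | _ :: _ => 0

/-- The sign of the letter `z i` (for `true`) or `(z i)⁻¹` (for `false`). -/
def letterSign (b : Bool) : ℤ := if b then 1 else -1

theorem letterSign_mul_self (b : Bool) : letterSign b * letterSign b = 1 := by
  cases b <;> rfl

/-- The function `v` on words is led by the letter `i` with sign `b`: for some word `t` that does
not begin with `i`, it vanishes on all words longer than `t` except those of length `t.length + 1`
that begin with `i`, and its value at `i :: t` is a nonzero multiple, of sign `b`, of its nonzero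
value at `t`. -/
def IsLedBy (i : J) (b : Bool) (v : List J → ℤ) : Prop :=
  ∃ (t : List J) (e : ℤ), t.head? ≠ some i ∧ v t ≠ 0 ∧ v (i :: t) = e * v t ∧
    0 < letterSign b * e ∧
    ∀ l : List J, t.length < l.length → v l ≠ 0 → l.length = t.length + 1 ∧ l.head? = some i

theorem wordRep_letter (z : FreeGroupBasis J F) (i : J) (b : Bool) (v : List J → ℤ) :
    wordRep z (z.repr.symm (FreeGroup.mk [(i, b)])) v = v + letterSign b • shift i v := by
  cases b with
  | true =>
    have h : z.repr.symm (FreeGroup.mk [(i, true)]) = z i := rfl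
    rw [h, wordRep_basis]
    simp [letterSign]
  | false =>
    have h : z.repr.symm (FreeGroup.mk [(i, false)]) = (z i)⁻¹ := by
      change _ = (z.repr.symm (FreeGroup.of i))⁻¹
      rw [← map_inv]
      rfl
    rw [h, wordRep_basis_inv]
    simp [letterSign, sub_eq_add_neg]

/-- Acting by a letter `(i, b)` makes a function led by `(i, b)`, provided that it does not
cancel against a leading letter. The value `e = 0` covers the case of a new letter. -/
theorem isLedBy_letter {i : J} {b : Bool} {v : List J → ℤ} {t : List J} {e : ℤ}
    (ht : t.head? ≠ some i) (hvt : v t ≠ 0) (hv : v (i :: t) = e * v t)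
    (he : 0 ≤ letterSign b * e)
    (hl : ∀ l : List J, t.length < l.length → v l ≠ 0 →
      l.length = t.length + 1 ∧ l.head? = some i) :
    IsLedBy i b (v + letterSign b • shift i v) := by
  have h1 : (v + letterSign b • shift i v) t = v t := by
    rw [Pi.add_apply, Pi.smul_apply, shift_of_head?_ne i v ht, smul_zero, add_zero]
  refine ⟨t, e + letterSign b, ht, h1 ▸ hvt, ?_, ?_, fun l hlt hvl => ?_⟩
  · rw [h1, Pi.add_apply, Pi.smul_apply, shift_cons i v ht, hv, smul_eq_mul, add_mul]
  · rw [mul_add, letterSign_mul_self]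
    omega
  · by_cases hvl' : v l = 0
    · have hs : shift i v l ≠ 0 := fun h => hvl (by
        rw [Pi.add_apply, Pi.smul_apply, h, hvl', smul_zero, add_zero])
      have hli : l.head? = some i := by
        by_contra h
        exact hs (shift_of_head?_ne i v h)
      cases l with
      | nil => simp at hli
      | cons a s =>
        obtain rfl : a = i := by simpa using hli
        have hsa : s.head? ≠ some a := by
          intro h
          apply hs
          simp [shift, h]
        rw [shift_cons a v hsa] at hs
        refine ⟨?_, rfl⟩
        by_contra hne
        refine hsa (hl s ?_ hs).2
        simp only [List.length_cons] at hlt hne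
        omega
    · exact hl l hlt hvl'

/-- A nonempty reduced word moves the indicator of the empty word to a function led by
its first letter. -/
theorem isLedBy_wordRep (z : FreeGroupBasis J F) (i : J) (b : Bool)
    (w : List (J × Bool)) (hw : FreeGroup.IsReduced ((i, b) :: w)) :
    IsLedBy i b (wordRep z (z.repr.symm (FreeGroup.mk ((i, b) :: w))) (emptyWord J)) := by
  induction w generalizing i b with
  | nil =>
    rw [wordRep_letter]
    refine isLedBy_letter (t := []) (e := 0) (by simp) one_ne_zero ?_ (by simp) fun l hl h => ?_
    · rw [zero_mul]; rfl
    · cases l with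
      | nil => simp at hl
      | cons a l => exact (h rfl).elim
  | cons p w ih =>
    obtain ⟨j, c⟩ := p
    rw [FreeGroup.isReduced_cons_cons] at hw
    have hmk : FreeGroup.mk ((i, b) :: (j, c) :: w) =
        FreeGroup.mk [(i, b)] * FreeGroup.mk ((j, c) :: w) := by
      rw [FreeGroup.mul_mk]; rfl
    rw [hmk, map_mul, map_mul, Module.End.mul_apply, wordRep_letter]
    obtain ⟨t, e, ht, hvt, hv, he, hl⟩ := ih j c hw.2
    by_cases hij : i = j
    · obtain rfl := hij
      obtain rfl := hw.1 rfl
      exact isLedBy_letter ht hvt hv he.le hl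
    · have he0 : e ≠ 0 := by rintro rfl; simp at he
      refine isLedBy_letter (t := j :: t) (e := 0) (by simpa using Ne.symm hij) ?_ ?_ (by simp)
        fun l hlt h => ?_
      · rw [hv]; exact mul_ne_zero he0 hvt
      · rw [zero_mul]
        by_contra h
        have := (hl (i :: j :: t) (by simp only [List.length_cons]; omega) h).1
        simp at this
      · simp only [List.length_cons] at hlt
        have := (hl l (by omega) h).1
        omega

/-- Free groups are residually nilpotent. -/
theorem eq_one_of_forall_mem_lcs (z : FreeGroupBasis J F) {g : F} (hg : ∀ n, g ∈ lcs F n) :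
    g = 1 := by
  classical
  have hfix : wordRep z g (emptyWord J) = emptyWord J := by
    funext l
    have h1 := wordAlgRep_mem z (del_mem_pow (l.length + 1) (hg _)) (n := 0) (v := emptyWord J)
      fun l hl => (Nat.not_lt_zero _ hl).elim
    have h2 := h1 l (by omega)
    rw [del, map_sub, map_one, wordAlgRep_of, LinearMap.sub_apply, Module.End.one_apply,
      Pi.sub_apply] at h2
    exact sub_eq_zero.1 h2
  have hg' : g = z.repr.symm (FreeGroup.mk (z.repr g).toWord) := by
    rw [FreeGroup.mk_toWord, MulEquiv.symm_apply_apply]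
  have hred := FreeGroup.isReduced_toWord (x := z.repr g)
  cases hw : (z.repr g).toWord with
  | nil => rwa [hw, ← FreeGroup.one_eq_mk, map_one] at hg'
  | cons p w =>
    obtain ⟨i, b⟩ := p
    rw [hw] at hg' hred
    obtain ⟨t, e, -, hvt, hv, he, -⟩ := isLedBy_wordRep z i b w hred
    rw [← hg', hfix] at hvt hv
    have he0 : e ≠ 0 := by rintro rfl; simp at he
    exact (mul_ne_zero he0 hvt hv.symm).elim

end Residual

/-! ### The Lie ring of the lower central series -/

section GradedLie

open scoped commutatorElement DirectSum

universe u v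

variable {F : Type u} [Group F]

theorem lcs_succ_le (F : Type u) [Group F] (n : ℕ) : lcs F (n + 1) ≤ lcs F n :=
  Subgroup.lowerCentralSeries_antitone ⊤ (by omega)

theorem lcs_antitone (F : Type u) [Group F] : Antitone (lcs F) :=
  antitone_nat_of_succ_le (lcs_succ_le F)

theorem commutator_lcs_le (m n : ℕ) : ⁅lcs F m, lcs F n⁆ ≤ lcs F (m + n) := by
  induction n generalizing m with
  | zero => exact Subgroup.commutator_le_left _ _
  | succ n ih =>
    have htop : ∀ k, ⁅lcs F k, (⊤ : Subgroup F)⁆ ≤ lcs F (k + 1) := by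
      intro k
      rcases Nat.eq_zero_or_pos k with rfl | hk
      · rw [zero_add, lcs_one]; exact le_top
      · rw [lcs_succ F k hk]
    rcases Nat.eq_zero_or_pos n with rfl | hn
    · exact (Subgroup.commutator_mono le_rfl le_top).trans (htop m)
    let N := lcs F (m + (n + 1))
    have hbot : ∀ K : Subgroup F, K.map (QuotientGroup.mk' N) = ⊥ ↔ K ≤ N := by
      intro K
      rw [Subgroup.map_eq_bot_iff, QuotientGroup.ker_mk']
    have h : ⁅⁅lcs F n, (⊤ : Subgroup F)⁆, lcs F m⁆ ≤ N := by
      rw [← hbot, Subgroup.map_commutator, Subgroup.map_commutator]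
      apply Subgroup.commutator_commutator_eq_bot_of_rotate
      · rw [← Subgroup.map_commutator, ← Subgroup.map_commutator, hbot, Subgroup.commutator_comm ⊤]
        refine (Subgroup.commutator_mono (htop m) le_rfl).trans ((ih (m + 1)).trans_eq ?_)
        congr 1
        omega
      · rw [← Subgroup.map_commutator, ← Subgroup.map_commutator, hbot]
        exact (Subgroup.commutator_mono (ih m) le_rfl).trans (htop (m + n))
    rw [lcs_succ F n hn, Subgroup.commutator_comm]
    exact h

theorem commutator_mem_lcs {m n : ℕ} {a b : F} (ha : a ∈ lcs F m) (hb : b ∈ lcs F n) :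
    ⁅a, b⁆ ∈ lcs F (m + n) :=
  commutator_lcs_le m n (Subgroup.commutator_mem_commutator ha hb)

instance (n : ℕ) : CommGroup (LcsGr F n) :=
  { (inferInstance : Group (LcsGr F n)) with
    mul_comm := by
      intro a b
      obtain ⟨a, rfl⟩ := QuotientGroup.mk_surjective a
      obtain ⟨b, rfl⟩ := QuotientGroup.mk_surjective b
      rw [← QuotientGroup.mk_mul, ← QuotientGroup.mk_mul, QuotientGroup.eq,
        Subgroup.mem_subgroupOf]
      have h : (((a * b)⁻¹ * (b * a) : ↥(lcs F n)) : F) = ⁅(b : F)⁻¹, (a : F)⁻¹⁆ := by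
        simp [commutatorElement_def, mul_assoc]
      rw [h]
      rcases Nat.eq_zero_or_pos n with rfl | hn
      · rw [zero_add, lcs_one]; trivial
      · exact lcs_antitone F (by omega) (commutator_mem_lcs (inv_mem b.2) (inv_mem a.2)) }

variable (F) in
/-- The graded group `⨁ F_n / F_{n+1}` associated with the lower central series. The summand of
index `0` is trivial. -/
abbrev GradedLie : Type u := ⨁ n : ℕ, Additive (LcsGr F n)

open Classical in
/-- The class of `g ∈ F_n` in the summand `F_n / F_{n+1}`; by convention zero if `g ∉ F_n`. -/
def grade (n : ℕ) (g : F) : GradedLie F :=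
  if hg : g ∈ lcs F n then
    DirectSum.of (fun n => Additive (LcsGr F n)) n
      (Additive.ofMul (QuotientGroup.mk (⟨g, hg⟩ : ↥(lcs F n))))
  else 0

theorem grade_of_mem {n : ℕ} {g : F} (hg : g ∈ lcs F n) :
    grade n g = DirectSum.of (fun n => Additive (LcsGr F n)) n
      (Additive.ofMul (QuotientGroup.mk (⟨g, hg⟩ : ↥(lcs F n)))) :=
  dif_pos hg

theorem grade_mul {n : ℕ} {g h : F} (hg : g ∈ lcs F n) (hh : h ∈ lcs F n) :
    grade n (g * h) = grade n g + grade n h := by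
  rw [grade_of_mem hg, grade_of_mem hh, grade_of_mem (mul_mem hg hh), ← map_add]
  rfl

theorem grade_eq_zero_iff {n : ℕ} {g : F} (hg : g ∈ lcs F n) :
    grade n g = 0 ↔ g ∈ lcs F (n + 1) := by
  rw [grade_of_mem hg, map_eq_zero_iff _ (DirectSum.of_injective n), ofMul_eq_zero,
    QuotientGroup.eq_one_iff, Subgroup.mem_subgroupOf]

theorem grade_one (n : ℕ) : grade n (1 : F) = 0 :=
  (grade_eq_zero_iff (one_mem _)).2 (one_mem _)

theorem grade_inv {n : ℕ} {g : F} (hg : g ∈ lcs F n) : grade n g⁻¹ = -grade n g := by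
  rw [eq_neg_iff_add_eq_zero, ← grade_mul (inv_mem hg) hg, inv_mul_cancel, grade_one]

theorem grade_conj {n : ℕ} {g : F} (hg : g ∈ lcs F n) (a : F) :
    grade n (a * g * a⁻¹) = grade n g := by
  have h : a * g * a⁻¹ = ⁅a, g⁆ * g := by simp [commutatorElement_def]
  have hc : ⁅a, g⁆ ∈ lcs F (n + 1) := by
    have := commutator_mem_lcs (m := 1) (by rw [lcs_one]; trivial : a ∈ lcs F 1) hg
    rwa [add_comm] at this
  rw [h, grade_mul (lcs_succ_le F n hc) hg, (grade_eq_zero_iff (lcs_succ_le F n hc)).2 hc, zero_add]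

theorem gradedLie_induction {p : GradedLie F → Prop} (x : GradedLie F) (zero : p 0)
    (add : ∀ x y, p x → p y → p (x + y)) (grade : ∀ n, ∀ g ∈ lcs F n, p (grade n g)) : p x := by
  induction x using DirectSum.induction_on with
  | zero => exact zero
  | of n a =>
    obtain ⟨g, hg⟩ := QuotientGroup.mk_surjective a.toMul
    have := grade n g g.2
    rw [grade_of_mem g.2] at this
    convert this
    exact hg.symm
  | add x y hx hy => exact add x y hx hy

theorem gradedLie_hom_ext {A : Type v} [AddCommGroup A] {f g : GradedLie F →+ A}
    (h : ∀ n, ∀ a ∈ lcs F n, f (grade n a) = g (grade n a)) : f = g := by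
  refine DFunLike.ext _ _ fun x => ?_
  induction x using gradedLie_induction with
  | zero => rw [map_zero, map_zero]
  | add x y hx hy => rw [map_add, map_add, hx, hy]
  | grade n a ha => exact h n a ha

/-- A family of homomorphisms `F_n → A` that vanish on `F_{n+1}` defines a homomorphism from the
graded group of the lower central series. -/
def gradedLift {A : Type v} [AddCommGroup A] (f : ∀ n, ↥(lcs F n) → A)
    (hmul : ∀ n a b, f n (a * b) = f n a + f n b)
    (hzero : ∀ n (a : ↥(lcs F n)), (a : F) ∈ lcs F (n + 1) → f n a = 0) : GradedLie F →+ A :=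
  DirectSum.toAddMonoid fun n => MonoidHom.toAdditiveLeft
    (QuotientGroup.lift _ (MonoidHom.mk' (fun a => Multiplicative.ofAdd (f n a)) fun a b => by
      rw [hmul, ofAdd_add]) fun a ha => congrArg Multiplicative.ofAdd (hzero n a ha))

theorem gradedLift_grade {A : Type v} [AddCommGroup A] (f : ∀ n, ↥(lcs F n) → A)
    (hmul : ∀ n a b, f n (a * b) = f n a + f n b)
    (hzero : ∀ n (a : ↥(lcs F n)), (a : F) ∈ lcs F (n + 1) → f n a = 0) {n : ℕ} {a : F}
    (ha : a ∈ lcs F n) :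
    gradedLift f hmul hzero (grade n a) = f n ⟨a, ha⟩ := by
  rw [grade_of_mem ha, gradedLift, DirectSum.toAddMonoid_of]
  rfl

theorem grade_commutator_mul_left {m n : ℕ} {a b c : F} (ha : a ∈ lcs F m) (hb : b ∈ lcs F m)
    (hc : c ∈ lcs F n) :
    grade (m + n) ⁅a * b, c⁆ = grade (m + n) ⁅a, c⁆ + grade (m + n) ⁅b, c⁆ := by
  have hbc := commutator_mem_lcs hb hc
  rw [commutatorElement_mul_left_eq_conj_mul,
    grade_mul (Subgroup.Normal.conj_mem inferInstance _ hbc a) (commutator_mem_lcs ha hc),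
    grade_conj hbc, add_comm]

theorem grade_commutator_comm {m n : ℕ} {a b : F} (ha : a ∈ lcs F m) (hb : b ∈ lcs F n) :
    grade (m + n) ⁅a, b⁆ = -grade (n + m) ⁅b, a⁆ := by
  rw [← commutatorElement_inv b a, ← grade_inv (commutator_mem_lcs hb ha), add_comm]

theorem grade_commutator_mul_right {m n : ℕ} {a b c : F} (ha : a ∈ lcs F m) (hb : b ∈ lcs F n)
    (hc : c ∈ lcs F n) :
    grade (m + n) ⁅a, b * c⁆ = grade (m + n) ⁅a, b⁆ + grade (m + n) ⁅a, c⁆ := by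
  rw [grade_commutator_comm ha (mul_mem hb hc), grade_commutator_mul_left hb hc ha, neg_add,
    grade_commutator_comm ha hb, grade_commutator_comm ha hc]

/-- The bracket of the graded group of the lower central series, induced by the commutators
`F_m × F_n → F_{m+n}`. -/
def gradedBracket (F : Type u) [Group F] : GradedLie F →+ GradedLie F →+ GradedLie F :=
  gradedLift
    (fun m a => gradedLift (fun n b => grade (m + n) ⁅(a : F), (b : F)⁆)
      (fun _ b c => grade_commutator_mul_right a.2 b.2 c.2)
      (fun n b hb => (grade_eq_zero_iff (commutator_mem_lcs a.2 b.2)).2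
        (commutator_mem_lcs (m := m) (n := n + 1) a.2 hb)))
    (fun m a b => gradedLie_hom_ext fun n c hc => by
      rw [AddMonoidHom.add_apply, gradedLift_grade _ _ _ hc, gradedLift_grade _ _ _ hc,
        gradedLift_grade _ _ _ hc]
      exact grade_commutator_mul_left a.2 b.2 hc)
    (fun m a ha => gradedLie_hom_ext fun n c hc => by
      rw [gradedLift_grade _ _ _ hc, AddMonoidHom.zero_apply,
        grade_eq_zero_iff (commutator_mem_lcs a.2 hc), add_right_comm]
      exact commutator_mem_lcs ha hc)

theorem gradedBracket_grade {m n : ℕ} {a b : F} (ha : a ∈ lcs F m) (hb : b ∈ lcs F n) :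
    gradedBracket F (grade m a) (grade n b) = grade (m + n) ⁅a, b⁆ := by
  rw [gradedBracket, gradedLift_grade _ _ _ ha, gradedLift_grade _ _ _ hb]

theorem gradedBracket_comm (x y : GradedLie F) : gradedBracket F x y = -gradedBracket F y x := by
  induction x using gradedLie_induction with
  | zero => simp
  | add x x' hx hx' => rw [map_add, map_add, AddMonoidHom.add_apply, hx, hx', neg_add]
  | grade m a ha =>
    induction y using gradedLie_induction with
    | zero => simp
    | add y y' hy hy' => rw [map_add, map_add, AddMonoidHom.add_apply, hy, hy', neg_add]
    | grade n b hb =>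
      rw [gradedBracket_grade ha hb, gradedBracket_grade hb ha, grade_commutator_comm ha hb]

theorem gradedBracket_self (x : GradedLie F) : gradedBracket F x x = 0 := by
  induction x using gradedLie_induction with
  | zero => simp
  | add x y hx hy =>
    rw [map_add, map_add, AddMonoidHom.add_apply, AddMonoidHom.add_apply, hx, hy,
      gradedBracket_comm x y]
    abel
  | grade m a ha => rw [gradedBracket_grade ha ha, commutatorElement_self, grade_one]

theorem gradedBracket_jacobi (x y w : GradedLie F) :
    gradedBracket F (gradedBracket F x y) w + gradedBracket F (gradedBracket F y w) x +
      gradedBracket F (gradedBracket F w x) y = 0 := by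
  induction x using gradedLie_induction with
  | zero => simp
  | add x x' hx hx' =>
    simp only [map_add, AddMonoidHom.add_apply]
    rw [← add_zero (0 : GradedLie F)]
    nth_rw 1 [← hx]
    rw [← hx']
    abel
  | grade m a ha =>
    induction y using gradedLie_induction with
    | zero => simp
    | add y y' hy hy' =>
      simp only [map_add, AddMonoidHom.add_apply]
      rw [← add_zero (0 : GradedLie F)]
      nth_rw 1 [← hy]
      rw [← hy']
      abel
    | grade n b hb =>
      induction w using gradedLie_induction with
      | zero => simp
      | add w w' hw hw' =>
        simp only [map_add, AddMonoidHom.add_apply]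
        rw [← add_zero (0 : GradedLie F)]
        nth_rw 1 [← hw]
        rw [← hw']
        abel
      | grade p c hc =>
        -- the conjugated arguments of the Hall-Witt identity do not change the graded classes
        have hab := commutator_mem_lcs ha hb
        have hbc := commutator_mem_lcs hb hc
        have hca := commutator_mem_lcs hc ha
        have hc' : b * c * b⁻¹ ∈ lcs F p := Subgroup.Normal.conj_mem inferInstance _ hc b
        have ha' : c * a * c⁻¹ ∈ lcs F m := Subgroup.Normal.conj_mem inferInstance _ ha c
        have hb' : a * b * a⁻¹ ∈ lcs F n := Subgroup.Normal.conj_mem inferInstance _ hb a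
        have h1 := commutator_mem_lcs hab hc'
        have h2 := commutator_mem_lcs hbc ha'
        have h3 := commutator_mem_lcs hca hb'
        have e2 : n + p + m = m + n + p := by omega
        have e3 : p + m + n = m + n + p := by omega
        have k1 : gradedBracket F (gradedBracket F (grade m a) (grade n b)) (grade p c) =
            grade (m + n + p) ⁅⁅a, b⁆, b * c * b⁻¹⁆ := by
          rw [gradedBracket_grade ha hb, ← grade_conj hc b, gradedBracket_grade hab hc']
        have k2 : gradedBracket F (gradedBracket F (grade n b) (grade p c)) (grade m a) =
            grade (n + p + m) ⁅⁅b, c⁆, c * a * c⁻¹⁆ := by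
          rw [gradedBracket_grade hb hc, ← grade_conj ha c, gradedBracket_grade hbc ha']
        have k3 : gradedBracket F (gradedBracket F (grade p c) (grade m a)) (grade n b) =
            grade (p + m + n) ⁅⁅c, a⁆, a * b * a⁻¹⁆ := by
          rw [gradedBracket_grade hc ha, ← grade_conj hb a, gradedBracket_grade hca hb']
        rw [k1, k2, k3]
        rw [e2] at h2 ⊢
        rw [e3] at h3 ⊢
        rw [← grade_mul h1 h2, ← grade_mul (mul_mem h1 h2) h3,
          commutatorElement_commutatorElement_conj_mul, grade_one]

instance : LieRing (GradedLie F) where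
  bracket x y := gradedBracket F x y
  add_lie x y w := by
    change gradedBracket F (x + y) w = _
    rw [map_add]; rfl
  lie_add x y w := map_add (gradedBracket F x) y w
  lie_self := gradedBracket_self
  leibniz_lie x y w := by
    change gradedBracket F x (gradedBracket F y w) =
      gradedBracket F (gradedBracket F x y) w + gradedBracket F y (gradedBracket F x w)
    have h := gradedBracket_jacobi x y w
    rw [gradedBracket_comm (gradedBracket F y w) x, gradedBracket_comm w x, map_neg,
      AddMonoidHom.neg_apply, gradedBracket_comm (gradedBracket F x w) y, neg_neg] at h
    rw [← sub_eq_zero, ← neg_eq_zero, ← h]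
    abel

theorem lie_grade {m n : ℕ} {a b : F} (ha : a ∈ lcs F m) (hb : b ∈ lcs F n) :
    ⁅grade m a, grade n b⁆ = grade (m + n) ⁅a, b⁆ :=
  gradedBracket_grade ha hb

/-- The Lie ring of the lower central series is generated by the classes in degree one of
generators of the group. -/
theorem grade_mem_closure {J : Type v} {z : J → F} (hz : Subgroup.closure (Set.range z) = ⊤) (n : ℕ)
    {g : F} (hg : g ∈ lcs F n) :
    grade n g ∈ AddSubgroup.closure
      {a | ∃ k, IsLieMonomial (fun j => grade 1 (z j)) Set.univ k a} := by
  have hone : ∀ g : F, g ∈ lcs F 1 := fun g => by rw [lcs_one]; trivial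
  have h1 : ∀ g : F, grade 1 g ∈ AddSubgroup.closure
      {a | ∃ k, IsLieMonomial (fun j => grade 1 (z j)) Set.univ k a} := by
    intro g
    have hg : g ∈ Subgroup.closure (Set.range z) := by rw [hz]; trivial
    induction hg using Subgroup.closure_induction with
    | mem g hg =>
      obtain ⟨j, rfl⟩ := hg
      exact AddSubgroup.subset_closure ⟨1, .letter j (Set.mem_univ _)⟩
    | one => rw [grade_one]; exact zero_mem _
    | mul g h _ _ hg hh => rw [grade_mul (hone g) (hone h)]; exact add_mem hg hh
    | inv g _ hg => rw [grade_inv (hone g)]; exact neg_mem hg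
  induction n generalizing g with
  | zero =>
    rw [(grade_eq_zero_iff hg).2 (hone g)]
    exact zero_mem _
  | succ n ih =>
    rcases Nat.eq_zero_or_pos n with rfl | hn
    · exact h1 g
    have hg' := hg
    rw [lcs_succ F n hn, Subgroup.commutator_def] at hg'
    have hsub : Subgroup.closure {g | ∃ g₁ ∈ lcs F n, ∃ g₂ ∈ (⊤ : Subgroup F), ⁅g₁, g₂⁆ = g} ≤
        lcs F (n + 1) := by rw [lcs_succ F n hn, Subgroup.commutator_def]
    clear hg
    induction hg' using Subgroup.closure_induction with
    | mem g hg =>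
      obtain ⟨a, ha, b, -, rfl⟩ := hg
      rw [← lie_grade ha (hone b)]
      have hb := h1 b
      have ha := ih ha
      generalize grade n a = x at ha
      generalize grade 1 b = y at hb
      induction ha using AddSubgroup.closure_induction with
      | mem x hx =>
        induction hb using AddSubgroup.closure_induction with
        | mem y hy =>
          obtain ⟨k, hx⟩ := hx
          obtain ⟨l, hy⟩ := hy
          exact AddSubgroup.subset_closure ⟨k + l, .lie k l x y hx hy⟩
        | zero => rw [lie_zero]; exact zero_mem _
        | add y w _ _ hy hw => rw [lie_add]; exact add_mem hy hw
        | neg y _ hy => rw [lie_neg]; exact neg_mem hy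
      | zero => rw [zero_lie]; exact zero_mem _
      | add x w _ _ hx hw => rw [add_lie]; exact add_mem hx hw
      | neg x _ hx => rw [neg_lie]; exact neg_mem hx
    | one => rw [grade_one]; exact zero_mem _
    | mul g h hg' hh' hg hh => rw [grade_mul (hsub hg') (hsub hh')]; exact add_mem hg hh
    | inv g hg' hg => rw [grade_inv (hsub hg')]; exact neg_mem hg

end GradedLie

/-! ### Symbols of elements of powers of the augmentation ideal -/

section Symbol

open scoped commutatorElement

universe u v w

variable {F : Type u} [Group F] {J : Type v}

theorem mul_mem_augIdeal_pow {m n : ℕ} {x y : MonoidAlgebra ℤ F} (hx : x ∈ augIdeal F ^ m)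
    (hy : y ∈ augIdeal F ^ n) : x * y ∈ augIdeal F ^ (m + n) := by
  induction n generalizing y with
  | zero => exact Ideal.mul_mem_right _ _ hx
  | succ n ih =>
    rw [Submodule.pow_succ] at hy
    refine Submodule.smul_induction_on hy (fun a ha b hb => ?_) fun a b ha hb => ?_
    · rw [smul_eq_mul, ← mul_assoc, ← add_assoc, Submodule.pow_succ]
      exact Ideal.mul_mem_mul (ih ha) hb
    · rw [mul_add]
      exact add_mem ha hb

theorem augIdeal_pow_succ_le (F : Type u) [Group F] (n : ℕ) :
    augIdeal F ^ (n + 1) ≤ augIdeal F ^ n :=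
  Ideal.pow_le_pow_right n.le_succ

/-- To prove a statement about the elements of `I ^ n` that is stable under linear combinations,
it suffices to prove it for the monomials of degree `n` and for the elements of `I ^ (n + 1)`. -/
theorem augIdeal_pow_induction (z : FreeGroupBasis J F) {n : ℕ} {p : MonoidAlgebra ℤ F → Prop}
    (mono : ∀ j : Fin n → J, p (monomial z j)) (high : ∀ x ∈ augIdeal F ^ (n + 1), p x)
    (add : ∀ x ∈ augIdeal F ^ n, ∀ y ∈ augIdeal F ^ n, p x → p y → p (x + y))
    (smul : ∀ r : ℤ, ∀ x ∈ augIdeal F ^ n, p x → p (r • x)) {x : MonoidAlgebra ℤ F}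
    (hx : x ∈ augIdeal F ^ n) : p x := by
  obtain ⟨m, hm, hr⟩ := exists_span_monomial z n hx
  have key : m ∈ augIdeal F ^ n ∧ p m := by
    clear hr
    induction hm using Submodule.span_induction with
    | mem m hm =>
      obtain ⟨l, rfl⟩ := hm
      exact ⟨monomial_mem z l, mono l⟩
    | zero => exact ⟨zero_mem _, high 0 (zero_mem _)⟩
    | add a b _ _ ha hb => exact ⟨add_mem ha.1 hb.1, add a ha.1 b hb.1 ha.2 hb.2⟩
    | smul r a _ ha => exact ⟨zsmul_mem ha.1 r, smul r a ha.1 ha.2⟩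
  have := add m key.1 (x - m) (augIdeal_pow_succ_le F n hr) key.2 (high _ hr)
  rwa [add_sub_cancel] at this

open Classical in
/-- The symbol of degree `n` of `x ∈ I ^ n`: the image of `x` under
`I ^ n → I ^ n / I ^ (n + 1) → H^{⊗ n} → T(H)`. By convention it is zero if `x ∉ I ^ n`. -/
def symbol (z : FreeGroupBasis J F) (n : ℕ) (x : MonoidAlgebra ℤ F) : TensorAlgebra ℤ (H F) :=
  if hx : x ∈ augIdeal F ^ n then TensorPower.toTensorAlgebra (iMap z n (augMk n x hx)) else 0

theorem symbol_of_mem (z : FreeGroupBasis J F) {n : ℕ} {x : MonoidAlgebra ℤ F}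
    (hx : x ∈ augIdeal F ^ n) :
    symbol z n x = TensorPower.toTensorAlgebra (iMap z n (augMk n x hx)) :=
  dif_pos hx

theorem symbol_add (z : FreeGroupBasis J F) {n : ℕ} {x y : MonoidAlgebra ℤ F}
    (hx : x ∈ augIdeal F ^ n) (hy : y ∈ augIdeal F ^ n) :
    symbol z n (x + y) = symbol z n x + symbol z n y := by
  rw [symbol_of_mem z hx, symbol_of_mem z hy, symbol_of_mem z (add_mem hx hy), ← map_add, ← map_add]
  rfl

theorem symbol_smul (z : FreeGroupBasis J F) {n : ℕ} (r : ℤ) {x : MonoidAlgebra ℤ F}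
    (hx : x ∈ augIdeal F ^ n) : symbol z n (r • x) = r • symbol z n x := by
  rw [symbol_of_mem z hx, symbol_of_mem z (zsmul_mem hx r), ← map_smul, ← map_smul]
  rfl

theorem symbol_sub (z : FreeGroupBasis J F) {n : ℕ} {x y : MonoidAlgebra ℤ F}
    (hx : x ∈ augIdeal F ^ n) (hy : y ∈ augIdeal F ^ n) :
    symbol z n (x - y) = symbol z n x - symbol z n y := by
  rw [eq_sub_iff_add_eq, ← symbol_add z (sub_mem hx hy) hy, sub_add_cancel]

theorem symbol_eq_zero (z : FreeGroupBasis J F) {n : ℕ} {x : MonoidAlgebra ℤ F}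
    (hx : x ∈ augIdeal F ^ (n + 1)) : symbol z n x = 0 := by
  have h : augMk n x (augIdeal_pow_succ_le F n hx) = 0 := by
    have := (augMk_eq_iff (augIdeal_pow_succ_le F n hx) (zero_mem (augIdeal F ^ n))).2
      (by rwa [sub_zero])
    rw [this]
    rfl
  rw [symbol_of_mem z (augIdeal_pow_succ_le F n hx), h, map_zero, map_zero]

theorem symbol_monomial (z : FreeGroupBasis J F) {n : ℕ} (j : Fin n → J) :
    symbol z n (monomial z j) = (List.ofFn fun s => TensorAlgebra.ι ℤ (toH (z (j s)))).prod := by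
  rw [symbol_of_mem z (monomial_mem z j), iMap_monomial, TensorPower.toTensorAlgebra_tprod,
    TensorAlgebra.tprod_apply]

theorem symbol_mul (z : FreeGroupBasis J F) {m n : ℕ} {x y : MonoidAlgebra ℤ F}
    (hx : x ∈ augIdeal F ^ m) (hy : y ∈ augIdeal F ^ n) :
    symbol z (m + n) (x * y) = symbol z m x * symbol z n y := by
  refine augIdeal_pow_induction z
    (p := fun x => symbol z (m + n) (x * y) = symbol z m x * symbol z n y)
    (fun j => ?_) (fun x hx => ?_) (fun x hx x' hx' h h' => ?_) (fun r x hx h => ?_) hx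
  · have hj := monomial_mem z j
    refine augIdeal_pow_induction z
      (p := fun y => symbol z (m + n) (monomial z j * y) = symbol z m (monomial z j) * symbol z n y)
      (fun l => ?_) (fun y hy => ?_) (fun y hy y' hy' h h' => ?_) (fun r y hy h => ?_) hy
    · have h : monomial z j * monomial z l = monomial z (Fin.append j l) := by
        unfold monomial
        rw [← List.prod_append, ← List.ofFn_fin_append]
        congr 2
        funext s
        induction s using Fin.addCases <;> simp
      rw [h, symbol_monomial, symbol_monomial, symbol_monomial, ← List.prod_append,
        ← List.ofFn_fin_append]
      congr 2
      funext s
      induction s using Fin.addCases <;> simp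
    · rw [symbol_eq_zero z hy, mul_zero]
      exact symbol_eq_zero z (mul_mem_augIdeal_pow (n := n + 1) hj hy)
    · rw [mul_add, symbol_add z (mul_mem_augIdeal_pow hj hy) (mul_mem_augIdeal_pow hj hy'), h, h',
        symbol_add z hy hy', mul_add]
    · rw [mul_smul_comm, symbol_smul z r (mul_mem_augIdeal_pow hj hy), h, symbol_smul z r hy,
        mul_smul_comm]
  · have h := mul_mem_augIdeal_pow hx hy
    rw [add_right_comm] at h
    rw [symbol_eq_zero z hx, symbol_eq_zero z h, zero_mul]
  · rw [add_mul, symbol_add z (mul_mem_augIdeal_pow hx hy) (mul_mem_augIdeal_pow hx' hy), h, h',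
      symbol_add z hx hx', add_mul]
  · rw [smul_mul_assoc, symbol_smul z r (mul_mem_augIdeal_pow hx hy), h, symbol_smul z r hx,
      smul_mul_assoc]

theorem del_mem_pow_one (g : F) : del g ∈ augIdeal F ^ 1 := by
  rw [Submodule.pow_one]
  exact del_mem g

theorem toH_mul (g h : F) : toH (g * h) = toH g + toH h := by
  rw [toH, map_mul, ofMul_mul]; rfl

theorem symbol_del (z : FreeGroupBasis J F) (g : F) :
    symbol z 1 (del g) = TensorAlgebra.ι ℤ (toH g) := by
  have hmul : ∀ g h : F, symbol z 1 (del (g * h)) = symbol z 1 (del g) + symbol z 1 (del h) := by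
    intro g h
    have h2 : del g * del h ∈ augIdeal F ^ (1 + 1) :=
      mul_mem_augIdeal_pow (del_mem_pow_one g) (del_mem_pow_one h)
    rw [del_mul, symbol_add z (add_mem (del_mem_pow_one g) (del_mem_pow_one h))
      (augIdeal_pow_succ_le F 1 h2), symbol_add z (del_mem_pow_one g) (del_mem_pow_one h),
      symbol_eq_zero z h2, add_zero]
  have h1 : MonoidHom.mk' (fun g => Multiplicative.ofAdd (symbol z 1 (del g)))
      (fun g h => by rw [hmul, ofAdd_add]) =
      MonoidHom.mk' (fun g => Multiplicative.ofAdd (TensorAlgebra.ι ℤ (toH g)))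
      (fun g h => by rw [toH_mul, map_add, ofAdd_add]) := by
    apply z.ext_hom
    intro j
    have h3 : del (z j) = monomial z (fun _ : Fin 1 => j) := by simp [monomial]
    have h4 : symbol z 1 (del (z j)) = TensorAlgebra.ι ℤ (toH (z j)) := by
      rw [h3, symbol_monomial]
      simp
    exact congrArg Multiplicative.ofAdd h4
  exact congrArg Multiplicative.toAdd (DFunLike.congr_fun h1 g)

theorem toTensorAlgebra_injective {R M : Type*} [CommRing R] [AddCommGroup M] [Module R M] (n : ℕ) :
    Function.Injective (TensorPower.toTensorAlgebra : ⨂[R]^n M →ₗ[R] TensorAlgebra R M) := by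
  intro x y h
  have key : ∀ x : ⨂[R]^n M, TensorAlgebra.toDirectSum (TensorPower.toTensorAlgebra x) =
      DirectSum.of (fun n => ⨂[R]^n M) n x := by
    intro x
    rw [← TensorAlgebra.toDirectSum_ofDirectSum (DirectSum.of (fun n => ⨂[R]^n M) n x)]
    congr 1
    exact (DirectSum.toAddMonoid_of (fun n => (TensorPower.toTensorAlgebra :
      ⨂[R]^n M →ₗ[R] TensorAlgebra R M).toAddMonoidHom) n x).symm
  exact DirectSum.of_injective (β := fun n => ⨂[R]^n M) n (by rw [← key, ← key, h])

/-- The formula for the symbol of a monomial holds for products of arbitrary elements `g - 1`. -/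
theorem symbol_monomial_id (z : FreeGroupBasis J F) {n : ℕ} (g : Fin n → F) :
    symbol z n (monomial id g) = (List.ofFn fun s => TensorAlgebra.ι ℤ (toH (g s))).prod := by
  induction n with
  | zero =>
    have h := symbol_monomial z (n := 0) Fin.elim0
    simp only [monomial, List.ofFn_zero] at h ⊢
    exact h
  | succ n ih =>
    rw [monomial_succ, symbol_mul z (monomial_mem _ _) (del_mem_pow_one _), ih, symbol_del,
      List.ofFn_succ', List.concat_eq_append, List.prod_append, List.prod_singleton]
    rfl

theorem iMap_monomial_id (z : FreeGroupBasis J F) {n : ℕ} (g : Fin n → F) :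
    iMap z n (augMk n (monomial id g) (monomial_mem id g)) =
      PiTensorProduct.tprod ℤ fun s => toH (g s) := by
  apply toTensorAlgebra_injective
  rw [← symbol_of_mem, TensorPower.toTensorAlgebra_tprod, TensorAlgebra.tprod_apply,
    symbol_monomial_id]

/-- The map `iMap` does not depend on the free basis. -/
theorem iMap_eq_iMap {J' : Type w} (z : FreeGroupBasis J F) (z' : FreeGroupBasis J' F) (n : ℕ) :
    iMap z' n = iMap z n := by
  apply (augBasis z' n).ext
  intro j
  rw [augBasis, Module.Basis.mk_apply, iMap_monomial]
  exact (iMap_monomial_id z fun s => z' (j s)).symm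

end Symbol

/-! ### Magnus' theorem: injectivity of the graded maps -/

section Injectivity

open scoped commutatorElement

universe u v w

variable {F : Type u} [Group F] {J : Type v}

/-- The additive isomorphism from the free abelian group on `J` to `H` given by a free basis. -/
def abEquiv (z : FreeGroupBasis J F) : FreeAbelianGroup J ≃+ H F :=
  MulEquiv.toAdditive z.repr.symm.abelianizationCongr

/-- The classes of a free basis form a basis of the abelianisation. -/
def abBasis (z : FreeGroupBasis J F) : Module.Basis J ℤ (H F) :=
  (FreeAbelianGroup.basis J).map (abEquiv z).toIntLinearEquiv

theorem abBasis_apply (z : FreeGroupBasis J F) (j : J) : abBasis z j = toH (z j) := by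
  have h : FreeAbelianGroup.basis J j = FreeAbelianGroup.of j := by
    simp [FreeAbelianGroup.basis]
  rw [abBasis, Module.Basis.map_apply, h]
  rfl

/-- The Magnus map: the Lie homomorphism from the graded Lie ring of the lower central series to
the tensor algebra of `H` that sends the class of `g ∈ F_n` to the symbol of `g - 1`. -/
def magnus (z : FreeGroupBasis J F) : GradedLie F →+ TensorAlgebra ℤ (H F) :=
  gradedLift (fun n a => symbol z n (del (a : F)))
    (fun n a b => by
      have ha := del_mem_pow n a.2
      have hb := del_mem_pow n b.2
      have hab : del (a : F) * del (b : F) ∈ augIdeal F ^ (n + 1) :=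
        mul_mem_augIdeal_pow ha (del_mem_pow_one _)
      rw [Subgroup.coe_mul, del_mul, symbol_add z (add_mem ha hb) (augIdeal_pow_succ_le F n hab),
        symbol_add z ha hb, symbol_eq_zero z hab, add_zero])
    (fun n a ha => symbol_eq_zero z (del_mem_pow (n + 1) ha))

theorem magnus_grade (z : FreeGroupBasis J F) {n : ℕ} {a : F} (ha : a ∈ lcs F n) :
    magnus z (grade n a) = symbol z n (del a) :=
  gradedLift_grade _ _ _ ha

theorem magnus_lie (z : FreeGroupBasis J F) (x y : GradedLie F) :
    magnus z ⁅x, y⁆ = magnus z x * magnus z y - magnus z y * magnus z x := by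
  induction x using gradedLie_induction with
  | zero => simp
  | add x x' hx hx' => rw [add_lie, map_add, map_add, hx, hx', add_mul, mul_add]; abel
  | grade m a ha =>
    induction y using gradedLie_induction with
    | zero => simp
    | add y y' hy hy' => rw [lie_add, map_add, map_add, hy, hy', add_mul, mul_add]; abel
    | grade n b hb =>
      have ha' := del_mem_pow m ha
      have hb' := del_mem_pow n hb
      have hab := mul_mem_augIdeal_pow ha' hb'
      have hba := mul_mem_augIdeal_pow hb' ha'
      rw [add_comm n m] at hba
      have hsub := sub_mem hab hba
      have h1 : del ⁅a, b⁆ = (del a * del b - del b * del a) +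
          (del a * del b - del b * del a) * del (a⁻¹ * b⁻¹) := by
        have h2 : ∀ g h : F, MonoidAlgebra.of ℤ F g * MonoidAlgebra.of ℤ F h =
          MonoidAlgebra.of ℤ F (g * h) := fun g h => (map_mul _ g h).symm
        have h3 : del a * del b - del b * del a =
            MonoidAlgebra.of ℤ F (a * b) - MonoidAlgebra.of ℤ F (b * a) := by
          rw [← h2, ← h2]
          simp only [del]
          noncomm_ring
        have h4 : a * b * (a⁻¹ * b⁻¹) = ⁅a, b⁆ := by simp [commutatorElement_def, mul_assoc]
        have h5 : b * a * (a⁻¹ * b⁻¹) = 1 := by group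
        rw [h3, del, del, mul_sub, sub_mul, h2, h2, mul_one, h4, h5, map_one]
        abel
      have h6 := mul_mem_augIdeal_pow hsub (del_mem_pow_one (a⁻¹ * b⁻¹))
      rw [lie_grade ha hb, magnus_grade z (commutator_mem_lcs ha hb), magnus_grade z ha,
        magnus_grade z hb, h1, symbol_add z hsub (augIdeal_pow_succ_le F _ h6),
        symbol_eq_zero z h6, add_zero, symbol_sub z hab hba, symbol_mul z ha' hb', add_comm m n,
        symbol_mul z hb' ha']

/-- Magnus' theorem: if the symbol of degree `n` of `g - 1` vanishes for `g ∈ F_n`, then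
`g ∈ F_{n+1}`. -/
theorem mem_lcs_succ_of_symbol_eq_zero (z : FreeGroupBasis J F) {n : ℕ} {g : F}
    (hg : g ∈ lcs F n) (h : symbol z n (del g) = 0) : g ∈ lcs F (n + 1) := by
  rw [← grade_eq_zero_iff hg]
  refine eq_zero_of_mem_closure_isLieMonomial (magnus z) (magnus_lie z)
    (g := fun j => grade 1 (z j)) ?_ (grade_mem_closure (closure_range_basis z) n hg) ?_
  · have h1 : FreeAlgebra.lift ℤ (fun j => magnus z (grade 1 (z j))) =
        (TensorAlgebra.equivFreeAlgebra (abBasis z)).symm.toAlgHom := by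
      ext j
      have hj : z j ∈ lcs F 1 := by rw [lcs_one]; trivial
      simp [magnus_grade z hj, symbol_del, abBasis_apply]
    rw [h1]
    exact (TensorAlgebra.equivFreeAlgebra (abBasis z)).symm.injective
  · rw [magnus_grade z hg, h]

theorem jMap_smul_tprod {n : ℕ} (r : ℤ) (a : Fin n → H F) :
    jMap F n (r • PiTensorProduct.tprod ℤ a) =
      (r : ℝ) • PiTensorProduct.tprod ℝ fun s => (1 : ℝ) ⊗ₜ[ℤ] a s := by
  rw [← jMap_tprod]
  exact map_intCast_smul (jMap F n) ℤ ℝ r _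

/-- In terms of the bases coming from a free basis, `jMap` is the inclusion of integral
coordinates into real ones. -/
theorem jMap_injective (z : FreeGroupBasis J F) (n : ℕ) : Function.Injective (jMap F n) := by
  let b := Basis.piTensorProduct fun _ : Fin n => abBasis z
  let c := Basis.piTensorProduct fun _ : Fin n => (abBasis z).baseChange ℝ
  have key : ∀ x p, c.repr (jMap F n x) p = ((b.repr x p : ℤ) : ℝ) := by
    intro x p
    induction x using PiTensorProduct.induction_on with
    | smul_tprod r a =>
      rw [jMap_smul_tprod]
      simp [b, c, Basis.piTensorProduct_repr_tprod_apply]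
    | add x y hx hy => rw [map_add, map_add, map_add, Finsupp.add_apply, Finsupp.add_apply, hx, hy,
        Int.cast_add]
  rw [injective_iff_map_eq_zero]
  intro x hx
  apply b.repr.injective
  ext p
  have := key x p
  rw [hx, map_zero, Finsupp.zero_apply] at this
  rw [map_zero, Finsupp.zero_apply]
  exact_mod_cast this.symm

end Injectivity

/-! ### Lexicographic orderings and positively triangular maps -/

section Lexicographic

universe u w

variable {M : Type u} [AddCommGroup M] [Module ℝ M] {I : Type w} [LinearOrder I]

theorem lexPos_iff {B : Module.Basis I ℝ M} {α : M} :
    LexPos B α ↔ ∃ i, 0 < B.repr α i ∧ ∀ j < i, B.repr α j = 0 := by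
  constructor
  · rintro ⟨i, hi, hpos⟩
    exact ⟨i, hpos, fun j hj => by_contra fun h => (hi.2 h).not_gt hj⟩
  · rintro ⟨i, hpos, h⟩
    exact ⟨i, ⟨hpos.ne', fun j hj => not_lt.1 fun hji => hj (h j hji)⟩, hpos⟩

theorem not_lexPos_zero (B : Module.Basis I ℝ M) : ¬ LexPos B 0 := by
  rintro ⟨i, hi, -⟩
  exact hi.1 (by rw [map_zero, Finsupp.zero_apply])

theorem LexPos.add {B : Module.Basis I ℝ M} {α β : M} (hα : LexPos B α) (hβ : LexPos B β) :
    LexPos B (α + β) := by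
  rw [lexPos_iff] at hα hβ ⊢
  obtain ⟨i, hi, hi'⟩ := hα
  obtain ⟨j, hj, hj'⟩ := hβ
  refine ⟨min i j, ?_, fun l hl => ?_⟩
  · rw [map_add, Finsupp.add_apply]
    rcases lt_trichotomy i j with h | h | h
    · rw [min_eq_left h.le, hj' i h, add_zero]; exact hi
    · subst h; rw [min_self]; exact add_pos hi hj
    · rw [min_eq_right h.le, hi' j h, zero_add]; exact hj
  · rw [map_add, Finsupp.add_apply, hi' l (hl.trans_le (min_le_left _ _)),
      hj' l (hl.trans_le (min_le_right _ _)), add_zero]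

theorem lexPos_or_lexPos_neg (B : Module.Basis I ℝ M) {α : M} (hα : α ≠ 0) :
    LexPos B α ∨ LexPos B (-α) := by
  have hne : (B.repr α).support.Nonempty := by
    rwa [Finsupp.support_nonempty_iff, Ne, LinearEquiv.map_eq_zero_iff]
  obtain ⟨i, hi, hmin⟩ : ∃ i, B.repr α i ≠ 0 ∧ ∀ j < i, B.repr α j = 0 := by
    refine ⟨(B.repr α).support.min' hne, Finsupp.mem_support_iff.1 (Finset.min'_mem _ _),
      fun j hj => ?_⟩
    by_contra h
    exact ((Finset.min'_le _ j (Finsupp.mem_support_iff.2 h)).trans_lt hj).false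
  rcases hi.lt_or_gt with h | h
  · refine Or.inr (lexPos_iff.2 ⟨i, ?_, fun j hj => ?_⟩)
    · rw [map_neg, Finsupp.neg_apply]; exact neg_pos.2 h
    · rw [map_neg, Finsupp.neg_apply, hmin j hj, neg_zero]
  · exact Or.inl (lexPos_iff.2 ⟨i, h, hmin⟩)

/-- A positively triangular map preserves positivity in the lexicographic ordering. -/
theorem LexPos.map {N : Type*} [AddCommGroup N] [Module ℝ N] {I' : Type*} [LinearOrder I']
    {B : Module.Basis I ℝ M} {C : Module.Basis I' ℝ N} {f : M →ₗ[ℝ] N} {η : I → I'}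
    (hη : StrictMono η) (hpos : ∀ i, 0 < C.repr (f (B i)) (η i))
    (hle : ∀ i j, C.repr (f (B i)) j ≠ 0 → η i ≤ j) {α : M} (hα : LexPos B α) :
    LexPos C (f α) := by
  have hsum : ∀ j, C.repr (f α) j = ∑ i ∈ (B.repr α).support, B.repr α i * C.repr (f (B i)) j := by
    intro j
    conv_lhs => rw [← B.linearCombination_repr α]
    rw [Finsupp.linearCombination_apply, Finsupp.sum, map_sum, map_sum, Finsupp.finsetSum_apply]
    refine Finset.sum_congr rfl fun i _ => ?_
    rw [map_smul, map_smul, Finsupp.smul_apply, smul_eq_mul]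
  rw [lexPos_iff] at hα ⊢
  obtain ⟨i, hi, hlt⟩ := hα
  refine ⟨η i, ?_, fun j hj => ?_⟩
  · rw [hsum, Finset.sum_eq_single i]
    · exact mul_pos hi (hpos i)
    · intro l _ hli
      rcases lt_or_gt_of_ne hli with h | h
      · rw [hlt l h, zero_mul]
      · rw [mul_eq_zero]
        exact Or.inr (by_contra fun h' => (hle l _ h').not_gt (hη h))
    · intro h
      rw [Finsupp.notMem_support_iff.1 h, zero_mul]
  · rw [hsum]
    refine Finset.sum_eq_zero fun l _ => ?_
    by_cases h : l < i
    · rw [hlt l h, zero_mul]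
    · rw [mul_eq_zero]
      exact Or.inr (by_contra fun h' =>
        ((hη.monotone (not_lt.1 h)).trans (hle l _ h')).not_gt hj)

theorem IsPositivelyTriangularWrt.exists_repr {B : Module.Basis I ℝ M} {f : M →ₗ[ℝ] M}
    (hf : IsPositivelyTriangularWrt B f) :
    ∃ η : I → I, StrictMono η ∧ (∀ i, 0 < B.repr (f (B i)) (η i)) ∧
      ∀ i j, B.repr (f (B i)) j ≠ 0 → η i ≤ j := by
  obtain ⟨η, hη, h⟩ := hf
  have key : ∀ i, ∃ (c₀ : ℝ) (c : I →₀ ℝ), 0 < c₀ ∧ (∀ j ∈ c.support, η i < j) ∧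
      B.repr (f (B i)) = Finsupp.single (η i) c₀ + c := by
    intro i
    obtain ⟨c₀, c, h0, hc, hfi⟩ := h i
    refine ⟨c₀, c, h0, hc, ?_⟩
    have h1 : (c.sum fun j r => r • B j) = B.repr.symm c := by
      rw [B.repr_symm_apply, Finsupp.linearCombination_apply]
    rw [hfi, map_add, map_smul, B.repr_self, h1, LinearEquiv.apply_symm_apply,
      Finsupp.smul_single, smul_eq_mul, mul_one]
  refine ⟨η, hη, fun i => ?_, fun i j hij => ?_⟩
  · obtain ⟨c₀, c, h0, hc, hr⟩ := key i
    have h1 : c (η i) = 0 := by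
      by_contra h
      exact (hc _ (Finsupp.mem_support_iff.2 h)).false
    rw [hr, Finsupp.add_apply, Finsupp.single_eq_same, h1, add_zero]
    exact h0
  · obtain ⟨c₀, c, h0, hc, hr⟩ := key i
    by_cases h : j = η i
    · exact h.ge
    · rw [hr, Finsupp.add_apply, Finsupp.single_eq_of_ne h, zero_add] at hij
      exact (hc j (Finsupp.mem_support_iff.2 hij)).le

/-- The tensor powers of a positively triangular map preserve positivity, since they are positively
triangular with respect to the lexicographically ordered tensor power of the basis. -/
theorem LexPos.map_tensorPower {B : Module.Basis I ℝ M} {f : M →ₗ[ℝ] M}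
    (hf : IsPositivelyTriangularWrt B f) {k : ℕ} {α : ⨂[ℝ]^k M}
    (hα : LexPos (tensorPowerBasis B k) α) :
    LexPos (tensorPowerBasis B k) (PiTensorProduct.map (fun _ => f) α) := by
  obtain ⟨η, hη, hpos, hle⟩ := hf.exists_repr
  have hrepr : ∀ s t : Lex (Fin k → I),
      (tensorPowerBasis B k).repr (PiTensorProduct.map (fun _ => f) (tensorPowerBasis B k s)) t =
        ∏ l : Fin k, B.repr (f (B (ofLex s l))) (ofLex t l) := by
    intro s t
    have h1 : tensorPowerBasis B k s = PiTensorProduct.tprod ℝ fun l => B (ofLex s l) := by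
      rw [tensorPowerBasis, Module.Basis.reindex_apply, Basis.piTensorProduct_apply]
      rfl
    rw [h1, PiTensorProduct.map_tprod, tensorPowerBasis, Module.Basis.repr_reindex_apply,
      Basis.piTensorProduct_repr_tprod_apply]
    rfl
  refine hα.map (η := fun s : Lex (Fin k → I) => toLex fun l => η (ofLex s l)) ?_
    (fun s => ?_) fun s t hst => ?_
  · rintro s t ⟨l, hl, hlt⟩
    exact ⟨l, fun m hm => congrArg η (hl m hm), hη hlt⟩
  · rw [hrepr]
    exact Finset.prod_pos fun l _ => hpos _
  · rw [hrepr] at hst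
    exact Pi.toLex_monotone fun l => hle _ _ (Finset.prod_ne_zero_iff.1 hst l (Finset.mem_univ l))

end Lexicographic

/-! ### The bi-ordering -/

section BiOrdering

open scoped commutatorElement

universe u v w

variable {F : Type u} [Group F] {J : Type v} {I : Type w} [LinearOrder I]

open Classical in
/-- The image of `a ∈ F_k` in `(H ⊗ ℝ)^{⊗ k}`. By convention it is zero if `a ∉ F_k`. -/
def leadingTensor (z : FreeGroupBasis J F) (k : ℕ) (a : F) : ⨂[ℝ]^k (HR F) :=
  if ha : a ∈ lcs F k then gradedMap z k (QuotientGroup.mk (⟨a, ha⟩ : ↥(lcs F k))) else 0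

theorem leadingTensor_of_mem (z : FreeGroupBasis J F) {k : ℕ} {a : F} (ha : a ∈ lcs F k) :
    leadingTensor z k a = gradedMap z k (QuotientGroup.mk (⟨a, ha⟩ : ↥(lcs F k))) :=
  dif_pos ha

theorem gradedMap_mul (z : FreeGroupBasis J F) (k : ℕ) (a b : LcsGr F k) :
    gradedMap z k (a * b) = gradedMap z k a + gradedMap z k b := by
  rw [gradedMap, map_mul, toAdd_mul, map_add, map_add]
  rfl

theorem gradedMap_one (z : FreeGroupBasis J F) (k : ℕ) : gradedMap z k 1 = 0 := by
  rw [gradedMap, map_one, toAdd_one, map_zero, map_zero]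

theorem leadingTensor_mul (z : FreeGroupBasis J F) {k : ℕ} {a b : F} (ha : a ∈ lcs F k)
    (hb : b ∈ lcs F k) : leadingTensor z k (a * b) = leadingTensor z k a + leadingTensor z k b := by
  rw [leadingTensor_of_mem z ha, leadingTensor_of_mem z hb, leadingTensor_of_mem z (mul_mem ha hb),
    ← gradedMap_mul]
  rfl

theorem leadingTensor_eq_zero_iff (z : FreeGroupBasis J F) {k : ℕ} {a : F} (ha : a ∈ lcs F k) :
    leadingTensor z k a = 0 ↔ a ∈ lcs F (k + 1) := by
  rw [leadingTensor_of_mem z ha]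
  constructor
  · intro h
    have h1 : iMap z k (augMk k (del a) (del_mem_pow k ha)) = 0 :=
      jMap_injective z k (h.trans (map_zero _).symm)
    refine mem_lcs_succ_of_symbol_eq_zero z ha ?_
    rw [symbol_of_mem z (del_mem_pow k ha), h1, map_zero]
  · intro h
    have h1 : (QuotientGroup.mk (⟨a, ha⟩ : ↥(lcs F k)) : LcsGr F k) = 1 :=
      (QuotientGroup.eq_one_iff _).2 h
    rw [h1, gradedMap_one]

theorem leadingTensor_one (z : FreeGroupBasis J F) (k : ℕ) : leadingTensor z k 1 = 0 :=
  (leadingTensor_eq_zero_iff z (one_mem _)).2 (one_mem _)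

theorem leadingTensor_inv (z : FreeGroupBasis J F) {k : ℕ} {a : F} (ha : a ∈ lcs F k) :
    leadingTensor z k a⁻¹ = -leadingTensor z k a := by
  rw [eq_neg_iff_add_eq_zero, ← leadingTensor_mul z (inv_mem ha) ha, inv_mul_cancel,
    leadingTensor_one]

theorem leadingTensor_conj (z : FreeGroupBasis J F) {k : ℕ} {a : F} (ha : a ∈ lcs F k) (g : F) :
    leadingTensor z k (g * a * g⁻¹) = leadingTensor z k a := by
  have hc : ⁅g, a⁆ ∈ lcs F (k + 1) := by
    have := commutator_mem_lcs (m := 1) (by rw [lcs_one]; trivial : g ∈ lcs F 1) ha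
    rwa [add_comm] at this
  have h : g * a * g⁻¹ = ⁅g, a⁆ * a := by simp [commutatorElement_def]
  rw [h, leadingTensor_mul z (lcs_succ_le F k hc) ha,
    (leadingTensor_eq_zero_iff z (lcs_succ_le F k hc)).2 hc, zero_add]

theorem assocPos_iff (z : FreeGroupBasis J F) (B : Module.Basis I ℝ (HR F)) (a : F) :
    AssocPos z B a ↔ ∃ k, a ∈ lcs F k ∧ LexPos (tensorPowerBasis B k) (leadingTensor z k a) := by
  constructor
  · rintro ⟨k, hk, h⟩
    refine ⟨k, hk.1, ?_⟩
    rw [GradedLT, LexLT, gradedMap_one, sub_zero] at h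
    rwa [leadingTensor_of_mem z hk.1]
  · rintro ⟨k, hk, h⟩
    have hk' : a ∉ lcs F (k + 1) := by
      intro h'
      rw [(leadingTensor_eq_zero_iff z hk).2 h'] at h
      exact not_lexPos_zero _ h
    refine ⟨k, ⟨hk, fun n hn => ?_⟩, ?_⟩
    · by_contra hkn
      exact hk' (lcs_antitone F (by omega) hn)
    · rw [GradedLT, LexLT, gradedMap_one, sub_zero]
      rwa [leadingTensor_of_mem z hk] at h

theorem not_assocPos_one (z : FreeGroupBasis J F) (B : Module.Basis I ℝ (HR F)) :
    ¬ AssocPos z B 1 := by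
  rw [assocPos_iff]
  rintro ⟨k, -, h⟩
  rw [leadingTensor_one] at h
  exact not_lexPos_zero _ h

theorem AssocPos.mul {z : FreeGroupBasis J F} {B : Module.Basis I ℝ (HR F)} {a b : F}
    (ha : AssocPos z B a) (hb : AssocPos z B b) : AssocPos z B (a * b) := by
  rw [assocPos_iff] at ha hb ⊢
  obtain ⟨k, hak, ha⟩ := ha
  obtain ⟨l, hbl, hb⟩ := hb
  -- the factor that lies deeper in the lower central series does not contribute
  rcases lt_trichotomy k l with h | rfl | h
  · have hbk := lcs_antitone F h hbl
    have hbk' := lcs_succ_le F k hbk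
    refine ⟨k, mul_mem hak hbk', ?_⟩
    rwa [leadingTensor_mul z hak hbk', (leadingTensor_eq_zero_iff z hbk').2 hbk, add_zero]
  · refine ⟨k, mul_mem hak hbl, ?_⟩
    rw [leadingTensor_mul z hak hbl]
    exact ha.add hb
  · have hal := lcs_antitone F h hak
    have hal' := lcs_succ_le F l hal
    refine ⟨l, mul_mem hal' hbl, ?_⟩
    rwa [leadingTensor_mul z hal' hbl, (leadingTensor_eq_zero_iff z hal').2 hal, zero_add]

theorem AssocPos.conj {z : FreeGroupBasis J F} {B : Module.Basis I ℝ (HR F)} {a : F}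
    (ha : AssocPos z B a) (g : F) : AssocPos z B (g * a * g⁻¹) := by
  rw [assocPos_iff] at ha ⊢
  obtain ⟨k, hak, ha⟩ := ha
  refine ⟨k, Subgroup.Normal.conj_mem inferInstance _ hak g, ?_⟩
  rwa [leadingTensor_conj z hak]

theorem assocPos_or_assocPos_inv (z : FreeGroupBasis J F) (B : Module.Basis I ℝ (HR F)) {a : F}
    (ha : a ≠ 1) : AssocPos z B a ∨ AssocPos z B a⁻¹ := by
  obtain ⟨k, hk, hk'⟩ : ∃ k, a ∈ lcs F k ∧ a ∉ lcs F (k + 1) := by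
    by_contra! h
    refine ha (eq_one_of_forall_mem_lcs z fun n => ?_)
    induction n with
    | zero => exact Subgroup.mem_top a
    | succ n ih => exact h n ih
  have hne : leadingTensor z k a ≠ 0 := fun h => hk' ((leadingTensor_eq_zero_iff z hk).1 h)
  rw [assocPos_iff, assocPos_iff]
  rcases lexPos_or_lexPos_neg (tensorPowerBasis B k) hne with h | h
  · exact Or.inl ⟨k, hk, h⟩
  · exact Or.inr ⟨k, inv_mem hk, by rwa [leadingTensor_inv z hk]⟩

theorem isBiOrdering_assocLT (z : FreeGroupBasis J F) (B : Module.Basis I ℝ (HR F)) :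
    IsBiOrdering (AssocLT z B) where
  strictTotal :=
    { irrefl := fun a h => by
        rw [AssocLT, inv_mul_cancel] at h
        exact not_assocPos_one z B h
      trans := fun a b c hab hbc => by
        have h := AssocPos.mul hab hbc
        rwa [mul_assoc, mul_inv_cancel_left] at h
      trichotomous := fun a b hab hba => by
        by_contra h
        have hne : a⁻¹ * b ≠ 1 := fun h' => h (inv_mul_eq_one.1 h')
        rcases assocPos_or_assocPos_inv z B hne with h' | h'
        · exact hab h'
        · rw [mul_inv_rev, inv_inv] at h'
          exact hba h' }
  mul_left f g h hfg := by
    have h1 : (h * f)⁻¹ * (h * g) = f⁻¹ * g := by group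
    rwa [AssocLT, h1]
  mul_right f g h hfg := by
    have h1 : (f * h)⁻¹ * (g * h) = h⁻¹ * (f⁻¹ * g) * h⁻¹⁻¹ := by group
    rw [AssocLT, h1]
    exact AssocPos.conj hfg h⁻¹

theorem assocLT_eq_assocLT {J' : Type*} (z : FreeGroupBasis J F) (z' : FreeGroupBasis J' F)
    (B : Module.Basis I ℝ (HR F)) : AssocLT z' B = AssocLT z B := by
  have h : gradedMap z' = gradedMap z := by
    funext k a
    rw [gradedMap, gradedMap, iMap_eq_iMap z z']
  funext a b
  simp only [AssocLT, AssocPos, GradedLT, h]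

end BiOrdering

/-! ### Invariance under automorphisms -/

section Invariance

universe u v w

variable {F : Type u} [Group F] {J : Type v} {I : Type w} [LinearOrder I]

/-- The endomorphism of the integral group ring induced by an automorphism of the group. -/
def groupRingMap (φ : F ≃* F) : MonoidAlgebra ℤ F →ₐ[ℤ] MonoidAlgebra ℤ F :=
  MonoidAlgebra.lift ℤ _ F ((MonoidAlgebra.of ℤ F).comp φ.toMonoidHom)

theorem groupRingMap_del (φ : F ≃* F) (g : F) : groupRingMap φ (del g) = del (φ g) := by
  simp [groupRingMap, del]

theorem aug_groupRingMap (φ : F ≃* F) (x : MonoidAlgebra ℤ F) :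
    aug F (groupRingMap φ x) = aug F x := by
  induction x using MonoidAlgebra.induction_on with
  | of g =>
    have h : groupRingMap φ (MonoidAlgebra.of ℤ F g) = MonoidAlgebra.of ℤ F (φ g) := by
      simp [groupRingMap]
    rw [h, aug_of, aug_of]
  | add x y hx hy => rw [map_add, map_add, hx, hy, map_add]
  | smul r x hx => rw [map_smul, map_smul, hx, map_smul]

theorem groupRingMap_mem (φ : F ≃* F) {n : ℕ} {x : MonoidAlgebra ℤ F} (hx : x ∈ augIdeal F ^ n) :
    groupRingMap φ x ∈ augIdeal F ^ n := by
  induction n generalizing x with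
  | zero => rw [Submodule.pow_zero, Ideal.one_eq_top]; trivial
  | succ n ih =>
    rw [Submodule.pow_succ] at hx
    refine Submodule.smul_induction_on hx (fun a ha b hb => ?_) fun a b ha hb => ?_
    · rw [smul_eq_mul, map_mul, Submodule.pow_succ]
      refine Ideal.mul_mem_mul (ih ha) ?_
      rwa [mem_augIdeal, aug_groupRingMap, ← mem_augIdeal]
    · rw [map_add]
      exact add_mem ha hb

theorem groupRingMap_monomial (φ : F ≃* F) (z : J → F) {n : ℕ} (j : Fin n → J) :
    groupRingMap φ (monomial z j) = monomial id fun s => φ (z (j s)) := by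
  rw [monomial, map_list_prod, List.map_ofFn, monomial]
  congr 2
  funext s
  exact groupRingMap_del φ _

theorem phiAb_toH (φ : F ≃* F) (g : F) : phiAb φ (toH g) = toH (φ g) := rfl

theorem symbol_groupRingMap (φ : F ≃* F) (z : FreeGroupBasis J F) {n : ℕ} {x : MonoidAlgebra ℤ F}
    (hx : x ∈ augIdeal F ^ n) :
    symbol z n (groupRingMap φ x) =
      TensorAlgebra.lift ℤ (TensorAlgebra.ι ℤ ∘ₗ phiAb φ) (symbol z n x) := by
  refine augIdeal_pow_induction z (p := fun x => symbol z n (groupRingMap φ x) =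
    TensorAlgebra.lift ℤ (TensorAlgebra.ι ℤ ∘ₗ phiAb φ) (symbol z n x))
    (fun j => ?_) (fun x hx => ?_) (fun x hx y hy h h' => ?_) (fun r x hx h => ?_) hx
  · rw [groupRingMap_monomial, symbol_monomial_id, symbol_monomial, map_list_prod, List.map_ofFn]
    congr 2
    funext s
    simp [phiAb_toH]
  · rw [symbol_eq_zero z hx, symbol_eq_zero z (groupRingMap_mem φ hx), map_zero]
  · rw [map_add, symbol_add z (groupRingMap_mem φ hx) (groupRingMap_mem φ hy), h, h',
      symbol_add z hx hy, map_add]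
  · rw [map_smul, symbol_smul z r (groupRingMap_mem φ hx), h, symbol_smul z r hx, map_smul]

theorem toTensorAlgebra_map {R M : Type*} [CommRing R] [AddCommGroup M] [Module R M] (f : M →ₗ[R] M)
    {n : ℕ} (x : ⨂[R]^n M) :
    TensorPower.toTensorAlgebra (PiTensorProduct.map (fun _ => f) x) =
      TensorAlgebra.lift R (TensorAlgebra.ι R ∘ₗ f) (TensorPower.toTensorAlgebra x) := by
  induction x using PiTensorProduct.induction_on with
  | smul_tprod r a =>
    rw [map_smul, map_smul, map_smul, map_smul, PiTensorProduct.map_tprod,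
      TensorPower.toTensorAlgebra_tprod, TensorPower.toTensorAlgebra_tprod,
      TensorAlgebra.tprod_apply, TensorAlgebra.tprod_apply, map_list_prod, List.map_ofFn]
    congr 3
    funext s
    simp
  | add x y hx hy => rw [map_add, map_add, map_add, map_add, hx, hy]

theorem iMap_groupRingMap (φ : F ≃* F) (z : FreeGroupBasis J F) {n : ℕ} {x : MonoidAlgebra ℤ F}
    (hx : x ∈ augIdeal F ^ n) :
    iMap z n (augMk n (groupRingMap φ x) (groupRingMap_mem φ hx)) =
      PiTensorProduct.map (fun _ => phiAb φ) (iMap z n (augMk n x hx)) := by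
  apply toTensorAlgebra_injective
  rw [toTensorAlgebra_map, ← symbol_of_mem, ← symbol_of_mem, symbol_groupRingMap φ z hx]

theorem jMap_map (φ : F ≃* F) {n : ℕ} (x : ⨂[ℤ]^n (H F)) :
    jMap F n (PiTensorProduct.map (fun _ => phiAb φ) x) =
      PiTensorProduct.map (fun _ => phiAbR φ) (jMap F n x) := by
  induction x using PiTensorProduct.induction_on with
  | smul_tprod r a =>
    rw [map_smul, PiTensorProduct.map_tprod, jMap_smul_tprod, jMap_smul_tprod, map_smul,
      PiTensorProduct.map_tprod]
    congr 2
  | add x y hx hy => rw [map_add, map_add, map_add, map_add, hx, hy]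

theorem map_mem_lcs (φ : F ≃* F) {k : ℕ} {a : F} (ha : a ∈ lcs F k) : φ a ∈ lcs F k := by
  have h : (lcs F k).Characteristic := by unfold lcs; infer_instance
  rw [← Subgroup.characteristic_iff_comap_eq.1 h φ] at ha
  exact ha

theorem leadingTensor_map (φ : F ≃* F) (z : FreeGroupBasis J F) {k : ℕ} {a : F}
    (ha : a ∈ lcs F k) :
    leadingTensor z k (φ a) = PiTensorProduct.map (fun _ => phiAbR φ) (leadingTensor z k a) := by
  have h1 : ∀ {a : F} (ha : a ∈ lcs F k), leadingTensor z k a =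
      jMap F k (iMap z k (augMk k (del a) (del_mem_pow k ha))) :=
    fun ha => leadingTensor_of_mem z ha
  rw [h1 ha, ← jMap_map, ← iMap_groupRingMap, h1 (map_mem_lcs φ ha)]
  simp only [groupRingMap_del]

theorem AssocPos.map {φ : F ≃* F} {z : FreeGroupBasis J F} {B : Module.Basis I ℝ (HR F)}
    (hφ : IsPositivelyTriangularWrt B (phiAbR φ)) {a : F} (ha : AssocPos z B a) :
    AssocPos z B (φ a) := by
  rw [assocPos_iff] at ha ⊢
  obtain ⟨k, hak, ha⟩ := ha
  refine ⟨k, map_mem_lcs φ hak, ?_⟩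
  rw [leadingTensor_map φ z hak]
  exact ha.map_tensorPower hφ

/-- The forward implication of the invariance is the preservation of positivity. The backward one
follows from it because the ordering is total. -/
theorem isInvariant_assocLT {φ : F ≃* F} (z : FreeGroupBasis J F) {B : Module.Basis I ℝ (HR F)}
    (hφ : IsPositivelyTriangularWrt B (phiAbR φ)) : IsInvariant (AssocLT z B) φ := by
  have hmap : ∀ f g : F, AssocLT z B f g → AssocLT z B (φ f) (φ g) := by
    intro f g h
    have h1 := AssocPos.map hφ h
    rwa [map_mul, map_inv] at h1
  have hst := (isBiOrdering_assocLT z B).strictTotal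
  refine fun f g => ⟨hmap f g, fun h => ?_⟩
  by_contra hfg
  by_cases hgf : AssocLT z B g f
  · exact hst.irrefl _ (hst.trans _ _ _ h (hmap g f hgf))
  · rw [hst.trichotomous f g hfg hgf] at h
    exact hst.irrefl _ h

end Invariance

end

end FreeGroupOrder

theorem theoremT {F : Type*} [Group F] {J : Type*} (z : FreeGroupBasis J F) :
    (∀ {I : Type*} [LinearOrder I] (B : Module.Basis I ℝ (FreeGroupOrder.HR F)),
      FreeGroupOrder.IsBiOrdering (FreeGroupOrder.AssocLT z B) ∧
      (∀ {J' : Type*} (z' : FreeGroupBasis J' F),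
        FreeGroupOrder.AssocLT z' B = FreeGroupOrder.AssocLT z B) ∧
      ∀ φ : F ≃* F,
        FreeGroupOrder.IsPositivelyTriangularWrt B (FreeGroupOrder.phiAbR φ) →
          FreeGroupOrder.IsInvariant (FreeGroupOrder.AssocLT z B) φ) ∧
    ∀ φ : F ≃* F, FreeGroupOrder.IsPositivelyTriangular (FreeGroupOrder.phiAbR φ) →
      ∃ lt : F → F → Prop, FreeGroupOrder.IsBiOrdering lt ∧ FreeGroupOrder.IsInvariant lt φ := by
  refine ⟨fun B => ⟨FreeGroupOrder.isBiOrdering_assocLT z B,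
    fun z' => FreeGroupOrder.assocLT_eq_assocLT z z' B,
    fun φ hφ => FreeGroupOrder.isInvariant_assocLT z hφ⟩, ?_⟩
  rintro φ ⟨I, _, B, hB⟩
  exact ⟨FreeGroupOrder.AssocLT z B, FreeGroupOrder.isBiOrdering_assocLT z B,
    FreeGroupOrder.isInvariant_assocLT z hB⟩
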